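/- Let $T$ be Thompson's group of all homeomorphisms $f$ of the circle $\mathbb{R}/\mathbb{Z}$ for which there is a finite set of dyadic points of the circle such that on each interval avoiding these points $f$ has the form $x\mapsto 2^k x+c \pmod 1$ with $k\in\mathbb{Z}$ and $c$ a dyadic rational. A tree diagram $(R,S,n)$ consists of two full binary trees $R,S$ with the same number $m$ of leaves and an integer $1\le n\le m$; the $i$-th leaf of $R$ is identified with the leaf of $S$ whose number is congruent to $i+n-1$ modulo $m$. Associate $[0,1)$ with the root of a tree and, if $[a,b)$ is associated with a vertex, associate $[a,\frac{a+b}{2})$ and $[\frac{a+b}{2},b)$ with its left and right child. The diagram represents the element of $T$ that maps the interval of each leaf of $R$ linearly onto the interval of the identified leaf of $S$. It is reduced if there is no pair consisting of a caret of $R$ and a caret of $S$ whose two children are leaves and such that the left and right leaves of the one are identified with the left and right leaves of the other. Every element of $T$ has exactly one reduced tree diagram. The Thompson graph of a full binary tree with $m$ leaves has vertices $v_1,\dots,v_m$, where $v_i$ is placed immediately to the left of the $i$-th leaf; each left edge of the tree, going from a vertex $u$ to its left child, contributes one edge of the graph, which joins $v_i$ and $v_j$, where the $i$-th and the $j$-th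 leaf are the leftmost leaves below the left and the right child of $u$ respectively (this is the edge that can be drawn above the line of leaves so that it crosses the tree only in the given left edge). The Thompson graph of $f\in T$ with reduced tree diagram $(R,S,n)$ is obtained from the Thompson graphs of $R$ and $S$ by identifying their vertices in the same way as the leaves. Let $\vec T$ be the set of all elements of $T$ whose Thompson graph is bipartite. Then $\vec T$ is a subgroup of $T$, and it coincides with its commensurator in $T$: $$\{t\in T \;:\; t\vec T t^{-1}\cap\vec T \text{ has finite index in both } \vec T \text{ and } t\vec Tt^{-1}\}=\vec T .$$ -/

import Mathlib

open Set Filter Topology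

/-! ### Thompson's group `T` -/

/-- A dyadic number: an integer multiple of an integer power of `2`. -/
def IsDyadic (x : ℝ) : Prop := ∃ (m : ℤ) (n : ℕ), x = m / 2 ^ n

/-- Membership in Thompson's group `T` for a homeomorphism of the circle `ℝ / ℤ`: there is a finite
set `B` of dyadic points of the circle such that, on every interval free of points of `B`, the
homeomorphism has the form `x ↦ 2 ^ k * x + c` modulo `1` with `k` an integer and `c` dyadic. -/
def IsThompson (f : UnitAddCircle ≃ₜ UnitAddCircle) : Prop :=
  ∃ B : Finset UnitAddCircle,
    (∀ p ∈ B, ∃ x : ℝ, IsDyadic x ∧ (x : UnitAddCircle) = p) ∧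
    ∀ a b : ℝ, (∀ x ∈ Ioo a b, (x : UnitAddCircle) ∉ B) →
      ∃ (k : ℤ) (c : ℝ), IsDyadic c ∧
        ∀ x ∈ Ioo a b, f (x : UnitAddCircle) = ((2 ^ k * x + c : ℝ) : UnitAddCircle)

/-! Facts needed to see that `T` is a group. -/

theorem IsDyadic.int (m : ℤ) : IsDyadic m := ⟨m, 0, by simp⟩

theorem IsDyadic.zero : IsDyadic 0 := ⟨0, 0, by simp⟩

theorem IsDyadic.add {x y : ℝ} (hx : IsDyadic x) (hy : IsDyadic y) : IsDyadic (x + y) := by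
  obtain ⟨m, n, rfl⟩ := hx
  obtain ⟨m', n', rfl⟩ := hy
  refine ⟨m * 2 ^ n' + m' * 2 ^ n, n + n', ?_⟩
  push_cast
  field_simp
  ring

theorem IsDyadic.neg {x : ℝ} (hx : IsDyadic x) : IsDyadic (-x) := by
  obtain ⟨m, n, rfl⟩ := hx
  exact ⟨-m, n, by push_cast; ring⟩

theorem IsDyadic.zpow_mul {x : ℝ} (hx : IsDyadic x) (k : ℤ) : IsDyadic (2 ^ k * x) := by
  obtain ⟨m, n, rfl⟩ := hx
  obtain ⟨j, rfl | rfl⟩ := Int.eq_nat_or_neg k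
  · exact ⟨2 ^ j * m, n, by push_cast; rw [zpow_natCast]; ring⟩
  · refine ⟨m, n + j, ?_⟩
    rw [zpow_neg, zpow_natCast]
    field_simp
    ring

theorem UnitAddCircle.coe_eq_coe {x y : ℝ} :
    (x : UnitAddCircle) = (y : UnitAddCircle) ↔ ∃ n : ℤ, x = y + n := by
  rw [eq_comm, QuotientAddGroup.eq, AddSubgroup.mem_zmultiples_iff]
  constructor
  · rintro ⟨n, hn⟩
    exact ⟨n, by simp only [zsmul_eq_mul, mul_one] at hn; linarith⟩
  · rintro ⟨n, rfl⟩
    exact ⟨n, by simp⟩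

/-- `f` is given by `z ↦ 2 ^ k * z + c` modulo `1` near the point `x`. -/
def AffineNear (f : UnitAddCircle → UnitAddCircle) (k : ℤ) (c x : ℝ) : Prop :=
  ∀ᶠ z : ℝ in 𝓝 x, f (z : UnitAddCircle) = ((2 ^ k * z + c : ℝ) : UnitAddCircle)

theorem AffineNear.unique {f : UnitAddCircle → UnitAddCircle} {k k' : ℤ} {c c' x : ℝ}
    (h : AffineNear f k c x) (h' : AffineNear f k' c' x) :
    k = k' ∧ (c : UnitAddCircle) = (c' : UnitAddCircle) := by
  have h1 : ∀ᶠ z : ℝ in 𝓝 x, |(2 ^ k - 2 ^ k' : ℝ) * (z - x)| < 1 := by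
    have hc : ContinuousAt (fun z : ℝ => |(2 ^ k - 2 ^ k' : ℝ) * (z - x)|) x := by fun_prop
    exact hc.eventually_lt continuousAt_const (by simp)
  have h2 : ∀ᶠ z : ℝ in 𝓝 x, ∃ n : ℤ, 2 ^ k * z + c = 2 ^ k' * z + c' + n := by
    filter_upwards [h, h'] with z hz hz'
    exact UnitAddCircle.coe_eq_coe.1 (hz.symm.trans hz')
  obtain ⟨n, hn⟩ := h2.self_of_nhds
  have h3 : ∃ᶠ z : ℝ in 𝓝[≠] x, True := by simp [frequently_true_iff_neBot]; infer_instance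
  obtain ⟨z, -, hzx, hz1, m, hm⟩ :=
    (h3.and_eventually
      (eventually_mem_nhdsWithin.and (nhdsWithin_le_nhds (h1.and h2)))).exists
  have h4 : (2 ^ k - 2 ^ k' : ℝ) * (z - x) = ((m - n : ℤ) : ℝ) := by
    push_cast; linarith
  rw [h4, ← Int.cast_abs] at hz1
  have h5 : m - n = 0 := by
    rw [← Int.abs_lt_one_iff]
    exact_mod_cast hz1
  rw [h5, Int.cast_zero, mul_eq_zero, sub_eq_zero, sub_eq_zero] at h4
  have h6 : (2 : ℝ) ^ k = 2 ^ k' := h4.resolve_right hzx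
  refine ⟨zpow_right_injective₀ (by norm_num) (by norm_num) h6, ?_⟩
  rw [h6] at hn
  exact UnitAddCircle.coe_eq_coe.2 ⟨n, by linarith⟩

theorem AffineNear.congr {f : UnitAddCircle → UnitAddCircle} {k : ℤ} {c c' x : ℝ}
    (h : AffineNear f k c x) (hc : (c : UnitAddCircle) = (c' : UnitAddCircle)) :
    AffineNear f k c' x := by
  filter_upwards [h] with z hz
  rw [hz, AddCircle.coe_add, AddCircle.coe_add, hc]

theorem AffineNear.on_Ioo {f : UnitAddCircle → UnitAddCircle} {a b : ℝ}
    (h : ∀ x ∈ Ioo a b, ∃ (k : ℤ) (c : ℝ), AffineNear f k c x) {k : ℤ} {c x y : ℝ}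
    (hx : x ∈ Ioo a b) (hy : y ∈ Ioo a b) (hk : AffineNear f k c x) : AffineNear f k c y := by
  have key := isPreconnected_Ioo.induction₂ (s := Ioo a b)
    (fun x y => ∀ (k : ℤ) (c : ℝ), AffineNear f k c x ↔ AffineNear f k c y) ?_ ?_ ?_ hx hy
  · exact (key k c).1 hk
  · intro x hx
    obtain ⟨k0, c0, h0⟩ := h x hx
    refine nhdsWithin_le_nhds ?_
    filter_upwards [h0.eventually_nhds] with y h0y k c
    have h0y : AffineNear f k0 c0 y := h0y
    constructor
    · intro hk
      obtain ⟨rfl, hc⟩ := hk.unique h0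
      exact h0y.congr hc.symm
    · intro hk
      obtain ⟨rfl, hc⟩ := hk.unique h0y
      exact h0.congr hc.symm
  · intro x y z _ _ _ h1 h2 k c
    exact (h1 k c).trans (h2 k c)
  · intro x y _ _ h1 k c
    exact (h1 k c).symm

theorem isThompson_iff_local (f : UnitAddCircle ≃ₜ UnitAddCircle) :
    IsThompson f ↔ ∃ B : Finset UnitAddCircle,
      (∀ p ∈ B, ∃ x : ℝ, IsDyadic x ∧ (x : UnitAddCircle) = p) ∧
      ∀ x : ℝ, (x : UnitAddCircle) ∉ B → ∃ (k : ℤ) (c : ℝ), IsDyadic c ∧ AffineNear f k c x := by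
  refine exists_congr fun B => and_congr_right fun _ => ⟨fun h x hx => ?_, fun h a b hab => ?_⟩
  · have hB : IsOpen {y : ℝ | (y : UnitAddCircle) ∉ B} :=
      (B.finite_toSet.isClosed.isOpen_compl).preimage (AddCircle.continuous_mk' 1)
    obtain ⟨a, b, hx', hab⟩ := mem_nhds_iff_exists_Ioo_subset.1 (hB.mem_nhds hx)
    obtain ⟨k, c, hc, hk⟩ := h a b fun y hy => hab hy
    exact ⟨k, c, hc, by filter_upwards [Ioo_mem_nhds hx'.1 hx'.2] with y hy using hk y hy⟩
  · rcases (Ioo a b).eq_empty_or_nonempty with he | ⟨x, hx⟩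
    · exact ⟨0, 0, IsDyadic.zero, by simp [he]⟩
    · obtain ⟨k, c, hc, hk⟩ := h x (hab x hx)
      refine ⟨k, c, hc, fun y hy => ?_⟩
      refine (AffineNear.on_Ioo (fun z hz => ?_) hx hy hk).self_of_nhds
      obtain ⟨k', c', -, hk'⟩ := h z (hab z hz)
      exact ⟨k', c', hk'⟩

theorem IsThompson.one : IsThompson 1 :=
  ⟨∅, by simp, fun _ _ _ => ⟨0, 0, IsDyadic.zero, by simp⟩⟩

theorem IsThompson.inv {f : UnitAddCircle ≃ₜ UnitAddCircle} (hf : IsThompson f) :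
    IsThompson f⁻¹ ∧ ∀ x : ℝ, IsDyadic x →
      ∃ y : ℝ, IsDyadic y ∧ f⁻¹ (x : UnitAddCircle) = (y : UnitAddCircle) := by
  classical
  rw [isThompson_iff_local] at hf
  obtain ⟨B, hB, h⟩ := hf
  have inv_apply : ∀ p q : UnitAddCircle, f p = q → f⁻¹ q = p := by
    rintro p q rfl
    exact f.symm_apply_apply p
  have main : ∀ x y : ℝ, f (x : UnitAddCircle) = (y : UnitAddCircle) → (x : UnitAddCircle) ∉ B →
      ∃ (k : ℤ) (c : ℝ), IsDyadic c ∧ AffineNear (f⁻¹ : UnitAddCircle ≃ₜ UnitAddCircle) k c y := by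
    intro x y hxy hx
    obtain ⟨k, c, hc, hk⟩ := h x hx
    have hy := hk.self_of_nhds
    rw [hxy] at hy
    obtain ⟨n, hn⟩ := UnitAddCircle.coe_eq_coe.1 hy
    refine ⟨-k, -(2 ^ (-k) * (c + n)), ((hc.add (.int n)).zpow_mul _).neg, ?_⟩
    have hk2 : (2 : ℝ) ^ k ≠ 0 := by positivity
    have ht : Tendsto (fun w : ℝ => 2 ^ (-k) * w + -(2 ^ (-k) * (c + n))) (𝓝 y) (𝓝 x) := by
      have hcont : Continuous (fun w : ℝ => 2 ^ (-k) * w + -(2 ^ (-k) * (c + n))) := by fun_prop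
      convert hcont.tendsto y using 2
      rw [hn, zpow_neg]
      field_simp
      ring
    filter_upwards [ht.eventually hk] with w hw
    apply inv_apply
    rw [hw, UnitAddCircle.coe_eq_coe]
    refine ⟨-n, ?_⟩
    push_cast
    rw [zpow_neg]
    field_simp
    ring
  constructor
  · rw [isThompson_iff_local]
    have dy : ∀ x : ℝ, IsDyadic x → ∃ y : ℝ, IsDyadic y ∧ (y : UnitAddCircle) = f x := by
      intro x hx
      -- f is affine immediately to the right of x, and continuous at x
      have hcl : ∃ b > x, ∀ z ∈ Ioo x b, (z : UnitAddCircle) ∉ B := by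
        have hB' : IsOpen {y : ℝ | (y : UnitAddCircle) ∉ B.erase (x : UnitAddCircle)} :=
          ((B.erase _).finite_toSet.isClosed.isOpen_compl).preimage (AddCircle.continuous_mk' 1)
        obtain ⟨a, b, hx', hab⟩ := mem_nhds_iff_exists_Ioo_subset.1
          (hB'.mem_nhds (x := x) (by simp))
        refine ⟨min b (x + 1), lt_min hx'.2 (by linarith), fun z hz hzB => ?_⟩
        have h1 : (z : UnitAddCircle) ∉ B.erase (x : UnitAddCircle) :=
          hab ⟨hx'.1.trans hz.1, hz.2.trans_le (min_le_left _ _)⟩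
        have h2 : (z : UnitAddCircle) = x := by
          by_contra hne
          exact h1 (Finset.mem_erase.2 ⟨hne, hzB⟩)
        obtain ⟨n, hn⟩ := UnitAddCircle.coe_eq_coe.1 h2
        have h3 : z < x + 1 := hz.2.trans_le (min_le_right _ _)
        have h4 := hz.1
        have h5 : (0 : ℝ) < n := by linarith
        have h6 : (n : ℝ) < 1 := by linarith
        have h5' : 0 < n := by exact_mod_cast h5
        have h6' : n < 1 := by exact_mod_cast h6
        omega
      obtain ⟨b, hb, hfree⟩ := hcl
      obtain ⟨z, hz⟩ := exists_between hb
      obtain ⟨k, c, hc, hk⟩ := h z (hfree z hz)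
      refine ⟨2 ^ k * x + c, (hx.zpow_mul k).add hc, ?_⟩
      have hk' : ∀ w ∈ Ioo x b, f (w : UnitAddCircle) = ((2 ^ k * w + c : ℝ) : UnitAddCircle) := by
        intro w hw
        refine (AffineNear.on_Ioo (fun u hu => ?_) hz hw hk).self_of_nhds
        obtain ⟨k', c', -, hk'⟩ := h u (hfree u hu)
        exact ⟨k', c', hk'⟩
      have l1 : Tendsto (fun w : ℝ => f (w : UnitAddCircle)) (𝓝[>] x) (𝓝 (f x)) :=
        ((f.continuous.comp (AddCircle.continuous_mk' 1)).tendsto x).mono_left nhdsWithin_le_nhds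
      have l2 : Tendsto (fun w : ℝ => ((2 ^ k * w + c : ℝ) : UnitAddCircle)) (𝓝[>] x)
          (𝓝 ((2 ^ k * x + c : ℝ) : UnitAddCircle)) :=
        (((AddCircle.continuous_mk' 1).comp (by fun_prop : Continuous fun w : ℝ =>
          2 ^ k * w + c)).tendsto x).mono_left nhdsWithin_le_nhds
      refine tendsto_nhds_unique (l2.congr' ?_) l1
      filter_upwards [Ioo_mem_nhdsGT hb] with w hw
      exact (hk' w hw).symm
    refine ⟨B.image f, ?_, fun y hy => ?_⟩
    · intro p hp
      obtain ⟨q, hq, rfl⟩ := Finset.mem_image.1 hp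
      obtain ⟨x, hx, rfl⟩ := hB q hq
      exact dy x hx
    · obtain ⟨x, hx⟩ := QuotientAddGroup.mk_surjective (f⁻¹ (y : UnitAddCircle))
      have hx : (x : UnitAddCircle) = f⁻¹ (y : UnitAddCircle) := hx
      have hxy : f (x : UnitAddCircle) = y := by rw [hx]; exact f.apply_symm_apply _
      refine main x y hxy fun hxB => hy ?_
      rw [← hxy]
      exact Finset.mem_image_of_mem f hxB
  · intro y hy
    obtain ⟨x, hx⟩ := QuotientAddGroup.mk_surjective (f⁻¹ (y : UnitAddCircle))
    have hx : (x : UnitAddCircle) = f⁻¹ (y : UnitAddCircle) := hx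
    have hxy : f (x : UnitAddCircle) = y := by rw [hx]; exact f.apply_symm_apply _
    by_cases hxB : (x : UnitAddCircle) ∈ B
    · obtain ⟨x', hx', he⟩ := hB _ hxB
      exact ⟨x', hx', by rw [he, hx]⟩
    · obtain ⟨k, c, hc, hk⟩ := main x y hxy hxB
      exact ⟨2 ^ k * y + c, (hy.zpow_mul k).add hc, hk.self_of_nhds⟩

theorem IsThompson.mul {g f : UnitAddCircle ≃ₜ UnitAddCircle} (hg : IsThompson g)
    (hf : IsThompson f) : IsThompson (g * f) := by
  classical
  have hinv := hf.inv.2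
  rw [isThompson_iff_local] at hf hg ⊢
  obtain ⟨B, hB, h⟩ := hf
  obtain ⟨C, hC, h'⟩ := hg
  refine ⟨B ∪ C.image (f⁻¹ : UnitAddCircle ≃ₜ UnitAddCircle), ?_, fun x hx => ?_⟩
  · intro p hp
    rcases Finset.mem_union.1 hp with hp | hp
    · exact hB p hp
    · obtain ⟨q, hq, rfl⟩ := Finset.mem_image.1 hp
      obtain ⟨y, hy, rfl⟩ := hC q hq
      obtain ⟨z, hz, he⟩ := hinv y hy
      exact ⟨z, hz, he.symm⟩
  · rw [Finset.mem_union, not_or] at hx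
    obtain ⟨k, c, hc, hk⟩ := h x hx.1
    have hfx := hk.self_of_nhds
    obtain ⟨l, d, hd, hl⟩ := h' (2 ^ k * x + c) (by
      intro hmem
      refine hx.2 (Finset.mem_image.2 ⟨_, hmem, ?_⟩)
      rw [← hfx]
      exact f.symm_apply_apply _)
    refine ⟨l + k, 2 ^ l * c + d, (hc.zpow_mul l).add hd, ?_⟩
    have ht : Tendsto (fun z : ℝ => 2 ^ k * z + c) (𝓝 x) (𝓝 (2 ^ k * x + c)) :=
      (by fun_prop : Continuous fun z : ℝ => 2 ^ k * z + c).tendsto x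
    filter_upwards [hk, ht.eventually hl] with z hz hz'
    change g (f z) = _
    rw [hz, hz', zpow_add₀ (by norm_num : (2 : ℝ) ≠ 0)]
    congr 1
    ring

/-- Thompson's group `T`, as a group of homeomorphisms of the circle `ℝ / ℤ`. -/
def thompsonT : Subgroup (UnitAddCircle ≃ₜ UnitAddCircle) where
  carrier := {f | IsThompson f}
  one_mem' := IsThompson.one
  mul_mem' hg hf := IsThompson.mul hg hf
  inv_mem' hf := hf.inv.1

/-! ### Pairs of trees -/

/-- Full binary trees: `BinaryTree.nil` is a leaf, `BinaryTree.node () l r` is a caret with left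
subtree `l` and right subtree `r`. Leaves are numbered from left to right, starting from `0`. -/
abbrev FullBinaryTree : Type := BinaryTree Unit

namespace FullBinaryTree

/-- The endpoints of the intervals `[a', b')` associated with the leaves of a tree, from left to
right, when the interval associated with the root is `[a, b)`. -/
noncomputable def leafIntervals : FullBinaryTree → ℝ → ℝ → List (ℝ × ℝ)
  | .nil, a, b => [(a, b)]
  | .node _ l r, a, b => leafIntervals l a ((a + b) / 2) ++ leafIntervals r ((a + b) / 2) b

/-- The leaves number `i` and `i + 1` are the two children of one and the same vertex. -/
def CaretAt : FullBinaryTree → ℕ → Prop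
  | .nil, _ => False
  | .node _ l r, i => (l = .nil ∧ r = .nil ∧ i = 0) ∨ CaretAt l i ∨
      ∃ i', i = l.numLeaves + i' ∧ CaretAt r i'

/-- Edges of the Thompson graph of a tree. The vertex `v i` lies immediately to the left of the leaf
number `i`. The left edge issuing from a vertex with left subtree `l` and right subtree `r` is
crossed by the edge that joins the vertex to the left of the first leaf of `l` and the vertex to the
left of the first leaf of `r`; each left edge of the tree contributes one such pair `i < j`. -/
def ThompsonEdge : FullBinaryTree → ℕ → ℕ → Prop
  | .nil, _, _ => False
  | .node _ l r, i, j => (i = 0 ∧ j = l.numLeaves) ∨ ThompsonEdge l i j ∨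
      ∃ i' j', i = l.numLeaves + i' ∧ j = l.numLeaves + j' ∧ ThompsonEdge r i' j'

end FullBinaryTree

/-- A tree diagram: an input tree `R` and an output tree `S` with the same number of leaves, and a
cyclic identification of their leaves, under which the first leaf of `R` corresponds to the leaf
number `shift` of `S` (counted from `0`). -/
structure TreeDiagram where
  R : FullBinaryTree
  S : FullBinaryTree
  shift : ℕ
  numLeaves_eq : S.numLeaves = R.numLeaves
  shift_lt : shift < R.numLeaves

namespace TreeDiagram

/-- The number of the leaf of `S` that is identified with the leaf number `i` of `R`. -/
def leafMatch (D : TreeDiagram) (i : ℕ) : ℕ := (i + D.shift) % D.R.numLeaves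

/-- `D` represents the circle map `f`: the interval of each leaf of `R` is mapped linearly by `f`
onto the interval of the identified leaf of `S`. -/
def Represents (D : TreeDiagram) (f : UnitAddCircle → UnitAddCircle) : Prop :=
  ∀ (i : ℕ) (I J : ℝ × ℝ), (D.R.leafIntervals 0 1)[i]? = some I →
    (D.S.leafIntervals 0 1)[D.leafMatch i]? = some J →
    ∀ x ∈ Ico I.1 I.2, f (x : UnitAddCircle) =
      ((J.1 + (J.2 - J.1) / (I.2 - I.1) * (x - I.1) : ℝ) : UnitAddCircle)

/-- `D` is reduced: there is no dipole, that is, no pair of carets of `R` and `S` with identified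
pairs of leaves. -/
def IsReduced (D : TreeDiagram) : Prop :=
  ∀ i, ¬ (D.R.CaretAt i ∧ D.S.CaretAt (D.leafMatch i))

/-- The Thompson graph of a tree diagram: the Thompson graphs of the two trees, with vertices
identified in the same way as the leaves. -/
def thompsonGraph (D : TreeDiagram) : SimpleGraph (Fin D.R.numLeaves) :=
  SimpleGraph.fromRel fun i j =>
    D.R.ThompsonEdge i j ∨ D.S.ThompsonEdge (D.leafMatch i) (D.leafMatch j)

end TreeDiagram

/-! ### Jones' subgroup -/

/-- Jones' subset of `T`: the elements whose reduced tree diagram has a bipartite Thompson graph. -/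
def jonesSet : Set thompsonT :=
  {f | ∃ D : TreeDiagram, D.Represents (f : UnitAddCircle ≃ₜ UnitAddCircle) ∧ D.IsReduced ∧
    D.thompsonGraph.IsBipartite}

/-!
The argument rests on the parity of the sum of the binary digits of a dyadic number.

The Thompson graph of a tree is connected, and each of its edges joins two leaves whose addresses
have digit sums of different parity (`FullBinaryTree.ThompsonEdge.exists_leaves`,
`FullBinaryTree.color_eq_digitParity`). Hence the Thompson graph of a diagram is bipartite if and
only if the parities of the addresses of identified leaves differ by a constant
(`TreeDiagram.isBipartite_thompsonGraph_iff`). Since the represented map replaces the address of a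
leaf of the input tree, as a prefix of a binary expansion, by that of the identified leaf of the
output tree, this says that the map preserves or reverses the parity of all dyadic numbers. The
elements of `T` doing so form the subgroup `parityStabilizer`. That it is all of `jonesSet` requires
a reduced diagram for each `f` in `T` (`IsThompson.exists_reduced_diagram`): the input tree is cut
out by the maximal standard dyadic intervals which `f` maps linearly onto standard dyadic intervals,
the output tree by those of the inverse of `f`. A dipole would contradict maximality.

For the commensurator, let `a` be the element `contraction` of the subgroup `V`; it fixes `0`,
and its powers move every dyadic point of `[0, 1)` into any given interval `[0, ε)`. If `t`
commensurates `V`, some power `b` of `a` with positive exponent satisfies `g b g⁻¹ ∈ V`, where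
`g = t⁻¹`. The parity difference `d` of `g x` and `x` then satisfies `d (b x) = d x + c` for a
constant `c`; evaluation at the fixed point `0` gives `c = 0`. As `d` is constant on an interval
`[0, ε)`, into which the powers of `b` move any dyadic point, `d` is constant, which means `g ∈ V`
(`mem_parityStabilizer_of_conj_mem`).
-/

/-! ### Binary words and dyadic intervals -/

/-- The number `0.u₁u₂…` with binary expansion `u`; it is the left endpoint of the interval
associated with the vertex of a binary tree whose address is `u` (`false` means left, `true` means
right). -/
noncomputable def wordValue : List Bool → ℝ
  | [] => 0
  | d :: u => ((if d then 1 else 0) + wordValue u) / 2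

/-- The length `2 ^ (-|u|)` of the interval associated with the vertex with address `u`. -/
noncomputable def wordWidth (u : List Bool) : ℝ := (1 / 2) ^ u.length

/-- The sum of the binary digits, modulo `2`. -/
def digitParity : List Bool → ZMod 2
  | [] => 0
  | d :: u => (if d then 1 else 0) + digitParity u

theorem wordWidth_pos (u : List Bool) : 0 < wordWidth u := by
  unfold wordWidth; positivity

theorem wordWidth_cons (d : Bool) (u : List Bool) : wordWidth (d :: u) = wordWidth u / 2 := by
  simp [wordWidth, pow_succ]; ring

theorem wordWidth_append (u w : List Bool) : wordWidth (u ++ w) = wordWidth u * wordWidth w := by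
  simp [wordWidth, pow_add]

theorem wordValue_append (u w : List Bool) :
    wordValue (u ++ w) = wordValue u + wordWidth u * wordValue w := by
  induction u with
  | nil => simp [wordValue, wordWidth]
  | cons d u ih => simp only [List.cons_append, wordValue, ih, wordWidth_cons]; ring

theorem digitParity_append (u w : List Bool) :
    digitParity (u ++ w) = digitParity u + digitParity w := by
  induction u with
  | nil => simp [digitParity]
  | cons d u ih => simp only [List.cons_append, digitParity, ih]; ring

theorem wordValue_nonneg (u : List Bool) : 0 ≤ wordValue u := by
  induction u with
  | nil => simp [wordValue]
  | cons d u ih => unfold wordValue; split_ifs <;> linarith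

theorem wordValue_add_wordWidth_le (u : List Bool) : wordValue u + wordWidth u ≤ 1 := by
  induction u with
  | nil => simp [wordValue, wordWidth]
  | cons d u ih => unfold wordValue; rw [wordWidth_cons]; split_ifs <;> linarith

theorem wordValue_lt_one (u : List Bool) : wordValue u < 1 := by
  linarith [wordValue_add_wordWidth_le u, wordWidth_pos u]

theorem wordValue_add_mul_mem_Ico (u : List Bool) {t : ℝ} (ht : t ∈ Ico (0 : ℝ) 1) :
    wordValue u + wordWidth u * t ∈ Ico (0 : ℝ) 1 := by
  have h1 := wordWidth_pos u
  have h2 := wordValue_nonneg u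
  have h3 := wordValue_add_wordWidth_le u
  constructor
  · nlinarith [ht.1]
  · nlinarith [ht.2]

theorem wordValue_mem_Ico (u : List Bool) : wordValue u ∈ Ico (0 : ℝ) 1 :=
  ⟨wordValue_nonneg u, wordValue_lt_one u⟩

theorem wordValue_replicate_false (k : ℕ) : wordValue (List.replicate k false) = 0 := by
  induction k with
  | zero => rfl
  | succ k ih => simp [List.replicate_succ, wordValue, ih]

theorem digitParity_replicate_false (k : ℕ) : digitParity (List.replicate k false) = 0 := by
  induction k with
  | zero => rfl
  | succ k ih => simp [List.replicate_succ, digitParity, ih]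

theorem wordValue_append_replicate_false (u : List Bool) (k : ℕ) :
    wordValue (u ++ List.replicate k false) = wordValue u := by
  simp [wordValue_append, wordValue_replicate_false]

theorem digitParity_append_replicate_false (u : List Bool) (k : ℕ) :
    digitParity (u ++ List.replicate k false) = digitParity u := by
  simp [digitParity_append, digitParity_replicate_false]

theorem coe_inj_of_mem_Ico {x y : ℝ} (hx : x ∈ Ico (0 : ℝ) 1) (hy : y ∈ Ico (0 : ℝ) 1)
    (h : (x : UnitAddCircle) = y) : x = y := by
  obtain ⟨n, hn⟩ := UnitAddCircle.coe_eq_coe.1 h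
  have h1 : (n : ℝ) < 1 := by linarith [hx.2, hy.1]
  have h2 : (-1 : ℝ) < n := by linarith [hx.1, hy.2]
  have h3 : n = 0 := by
    have : n < 1 := by exact_mod_cast h1
    have : -1 < n := by exact_mod_cast h2
    omega
  simpa [h3] using hn

theorem wordValue_cons_inj {d d' : Bool} {u u' : List Bool}
    (h : wordValue (d :: u) = wordValue (d' :: u')) : d = d' ∧ wordValue u = wordValue u' := by
  have h1 := wordValue_mem_Ico u
  have h2 := wordValue_mem_Ico u'
  rcases d with _ | _ <;> rcases d' with _ | _ <;> simp [wordValue] at h <;>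
    first
    | exact ⟨rfl, by linarith⟩
    | (exfalso; linarith [h1.1, h1.2, h2.1, h2.2])

theorem wordValue_eq_zero {u : List Bool} (h : wordValue u = 0) : digitParity u = 0 := by
  induction u with
  | nil => rfl
  | cons d u ih =>
    have h0 : wordValue (d :: u) = wordValue (false :: []) := by rw [h]; simp [wordValue]
    obtain ⟨rfl, h1⟩ := wordValue_cons_inj h0
    simp [digitParity, ih h1]

/-- The digit parity depends only on the dyadic number, not on the expansion. -/
theorem digitParity_eq_of_wordValue_eq {u v : List Bool} (h : wordValue u = wordValue v) :
    digitParity u = digitParity v := by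
  induction u generalizing v with
  | nil => exact (wordValue_eq_zero h.symm).symm
  | cons d u ih =>
    cases v with
    | nil => exact wordValue_eq_zero h
    | cons d' v =>
      obtain ⟨rfl, h1⟩ := wordValue_cons_inj h
      simp [digitParity, ih h1]

theorem digitParity_eq_of_coe_eq {u v : List Bool}
    (h : (wordValue u : UnitAddCircle) = wordValue v) : digitParity u = digitParity v :=
  digitParity_eq_of_wordValue_eq
    (coe_inj_of_mem_Ico (wordValue_mem_Ico u) (wordValue_mem_Ico v) h)

theorem eq_of_wordValue_eq {u v : List Bool} (hl : u.length = v.length)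
    (h : wordValue u = wordValue v) : u = v := by
  induction u generalizing v with
  | nil => exact (List.length_eq_zero_iff.1 hl.symm).symm
  | cons d u ih =>
    cases v with
    | nil => simp at hl
    | cons d' v =>
      obtain ⟨rfl, h1⟩ := wordValue_cons_inj h
      rw [ih (by simpa using hl) h1]

theorem wordWidth_inj {u v : List Bool} (h : wordWidth u = wordWidth v) : u.length = v.length :=
  pow_right_injective₀ (by norm_num : (0 : ℝ) < 1 / 2) (by norm_num) h

theorem exists_wordValue_eq_natCast_div (n m : ℕ) (h : m < 2 ^ n) :
    ∃ u : List Bool, u.length = n ∧ wordValue u = m / 2 ^ n := by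
  induction n generalizing m with
  | zero => exact ⟨[], rfl, by simp at h; simp [wordValue, h]⟩
  | succ n ih =>
    rw [pow_succ] at h
    by_cases hm : m < 2 ^ n
    · obtain ⟨u, hu, hv⟩ := ih m hm
      refine ⟨false :: u, by simp [hu], ?_⟩
      simp [wordValue, hv, pow_succ]; field_simp
    · obtain ⟨u, hu, hv⟩ := ih (m - 2 ^ n) (by omega)
      refine ⟨true :: u, by simp [hu], ?_⟩
      rw [Nat.cast_sub (by omega)] at hv
      simp [wordValue, hv, pow_succ]; field_simp; ring

theorem exists_coe_wordValue_eq_intCast_div (n : ℕ) (m : ℤ) :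
    ∃ u : List Bool, u.length = n ∧
      (wordValue u : UnitAddCircle) = ((m / 2 ^ n : ℝ) : UnitAddCircle) := by
  have hpos : (0 : ℤ) < 2 ^ n := by positivity
  have h0 := Int.emod_nonneg m hpos.ne'
  have h1 := Int.emod_lt_of_pos m hpos
  obtain ⟨u, hu, hv⟩ := exists_wordValue_eq_natCast_div n (m % 2 ^ n).toNat (by zify; omega)
  refine ⟨u, hu, UnitAddCircle.coe_eq_coe.2 ⟨-(m / 2 ^ n), ?_⟩⟩
  have h2 : (((m % 2 ^ n).toNat : ℕ) : ℝ) = m - 2 ^ n * ((m / 2 ^ n : ℤ) : ℝ) := by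
    have : (((m % 2 ^ n).toNat : ℕ) : ℤ) = m - 2 ^ n * (m / 2 ^ n) := by
      rw [Int.toNat_of_nonneg h0, Int.emod_def]
    exact_mod_cast this
  rw [hv, h2]
  push_cast
  field_simp
  ring

theorem IsDyadic.exists_wordValue {x : ℝ} (hx : IsDyadic x) :
    ∃ u : List Bool, (wordValue u : UnitAddCircle) = x := by
  obtain ⟨m, n, rfl⟩ := hx
  obtain ⟨u, -, hu⟩ := exists_coe_wordValue_eq_intCast_div n m
  exact ⟨u, hu⟩

theorem exists_natCast_eq_wordValue_mul (u : List Bool) :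
    ∃ m : ℕ, wordValue u = m / 2 ^ u.length := by
  induction u with
  | nil => exact ⟨0, by simp [wordValue]⟩
  | cons d u ih =>
    obtain ⟨m, hm⟩ := ih
    refine ⟨(if d then 2 ^ u.length else 0) + m, ?_⟩
    rw [wordValue, hm]
    cases d <;> simp [pow_succ] <;> field_simp

theorem isDyadic_wordValue (u : List Bool) : IsDyadic (wordValue u) := by
  obtain ⟨m, hm⟩ := exists_natCast_eq_wordValue_mul u
  exact ⟨m, u.length, by rw [hm]; simp⟩

/-- A word has the property `P`, but loses it when its last letter is dropped. For a property
inherited by extensions of words these are the words satisfying `P` without proper prefixes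
satisfying `P`. -/
def MaximalWord (P : List Bool → Prop) (u : List Bool) : Prop :=
  P u ∧ ∀ w d, u = w ++ [d] → ¬ P w

/-- A maximal word does not properly extend another word with the property. -/
theorem MaximalWord.eq_of_append {P : List Bool → Prop} (hP : ∀ u w, P u → P (u ++ w))
    {u w : List Bool} (h : MaximalWord P (u ++ w)) (hu : P u) : w = [] := by
  rcases List.eq_nil_or_concat w with rfl | ⟨w', d, rfl⟩
  · rfl
  · exact absurd (hP u w' hu) (h.2 (u ++ w') d (by simp))

/-! ### Addresses of the leaves of a tree -/

namespace FullBinaryTree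

/-- The addresses of the leaves of a tree, from left to right. -/
def leafWords : FullBinaryTree → List (List Bool)
  | .nil => [[]]
  | .node _ l r => (leafWords l).map (List.cons false) ++ (leafWords r).map (List.cons true)

theorem length_leafWords (t : FullBinaryTree) : t.leafWords.length = t.numLeaves := by
  induction t with
  | nil => rfl
  | node _ l r hl hr => simp [leafWords, hl, hr]

theorem leafIntervals_eq_map (t : FullBinaryTree) (a b : ℝ) :
    t.leafIntervals a b = t.leafWords.map fun u =>
      (a + (b - a) * wordValue u, a + (b - a) * (wordValue u + wordWidth u)) := by
  induction t generalizing a b with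
  | nil => simp [leafIntervals, leafWords, wordValue, wordWidth]
  | node _ l r hl hr =>
    simp only [leafIntervals, leafWords, hl, hr, List.map_append, List.map_map]
    congr 1 <;> refine List.map_congr_left fun u _ => ?_ <;>
      simp only [Function.comp_apply, wordValue, wordWidth_cons, Prod.mk.injEq] <;>
      constructor <;> simp <;> ring

theorem leafWords_node_left {l r : FullBinaryTree} {x : Unit} {i : ℕ} {u : List Bool}
    (h : l.leafWords[i]? = some u) :
    (leafWords (.node x l r))[i]? = some (false :: u) := by
  obtain ⟨hi, -⟩ := List.getElem?_eq_some_iff.1 h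
  simp only [leafWords]
  rw [List.getElem?_append_left (by simpa using hi)]
  simp [h]

theorem leafWords_node_right {l r : FullBinaryTree} {x : Unit} {i : ℕ} {u : List Bool}
    (h : r.leafWords[i]? = some u) :
    (leafWords (.node x l r))[l.numLeaves + i]? = some (true :: u) := by
  simp only [leafWords]
  rw [List.getElem?_append_right (by simp [length_leafWords])]
  simp [h, length_leafWords]

theorem leafWords_node_cases {l r : FullBinaryTree} {x : Unit} {i : ℕ} {u : List Bool}
    (h : (leafWords (.node x l r))[i]? = some u) :
    (i < l.numLeaves ∧ ∃ w, l.leafWords[i]? = some w ∧ u = false :: w) ∨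
    ∃ j w, i = l.numLeaves + j ∧ r.leafWords[j]? = some w ∧ u = true :: w := by
  simp only [leafWords] at h
  by_cases hi : i < l.numLeaves
  · left
    rw [List.getElem?_append_left (by simpa [length_leafWords] using hi), List.getElem?_map,
      Option.map_eq_some_iff] at h
    obtain ⟨w, hw, rfl⟩ := h
    exact ⟨hi, w, hw, rfl⟩
  · right
    rw [List.getElem?_append_right (by simpa [length_leafWords] using hi), List.getElem?_map,
      Option.map_eq_some_iff] at h
    obtain ⟨w, hw, rfl⟩ := h
    refine ⟨i - l.numLeaves, w, by omega, by simpa [length_leafWords] using hw, rfl⟩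

theorem exists_leafWords_of_lt (t : FullBinaryTree) {i : ℕ} (hi : i < t.numLeaves) :
    ∃ u, t.leafWords[i]? = some u := by
  rw [← length_leafWords] at hi
  exact ⟨_, List.getElem?_eq_getElem hi⟩

theorem lt_numLeaves_of_leafWords {t : FullBinaryTree} {i : ℕ} {u : List Bool}
    (h : t.leafWords[i]? = some u) : i < t.numLeaves := by
  obtain ⟨hi, -⟩ := List.getElem?_eq_some_iff.1 h
  rwa [length_leafWords] at hi

/-- Leaf intervals cover `[0, 1)`: after padding with zeros, every word runs through a leaf. -/
theorem exists_leaf_prefix (t : FullBinaryTree) (u : List Bool) :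
    ∃ (i k : ℕ) (r w : List Bool), t.leafWords[i]? = some r ∧
      u ++ List.replicate k false = r ++ w := by
  induction t generalizing u with
  | nil => exact ⟨0, 0, [], u, rfl, by simp⟩
  | node _ l r hl hr =>
    cases u with
    | nil =>
      obtain ⟨i, k, s, w, hs, h⟩ := hl []
      refine ⟨i, k + 1, false :: s, w, leafWords_node_left hs, ?_⟩
      rw [List.nil_append] at h ⊢
      rw [List.replicate_succ, h, List.cons_append]
    | cons d u =>
      cases d with
      | false =>
        obtain ⟨i, k, s, w, hs, h⟩ := hl u
        exact ⟨i, k, false :: s, w, leafWords_node_left hs, by simp [h]⟩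
      | true =>
        obtain ⟨i, k, s, w, hs, h⟩ := hr u
        exact ⟨_, k, true :: s, w, leafWords_node_right hs, by simp [h]⟩

theorem wordValue_leaf_zero {t : FullBinaryTree} {u : List Bool}
    (h : t.leafWords[0]? = some u) : wordValue u = 0 := by
  induction t generalizing u with
  | nil => simp [leafWords] at h; simp [h, wordValue]
  | node _ l r hl hr =>
    rcases leafWords_node_cases h with ⟨-, w, hw, rfl⟩ | ⟨j, w, hj, -, -⟩
    · simp [wordValue, hl hw]
    · have := l.numLeaves_pos
      omega

theorem rightEnd_leaf_last {t : FullBinaryTree} {i : ℕ} {u : List Bool}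
    (h : t.leafWords[i]? = some u) (hi : i + 1 = t.numLeaves) :
    wordValue u + wordWidth u = 1 := by
  induction t generalizing i u with
  | nil =>
    obtain rfl : i = 0 := by simpa using hi
    simp [leafWords] at h; simp [h, wordValue, wordWidth]
  | node _ l r hl hr =>
    simp only [BinaryTree.numLeaves] at hi
    have := r.numLeaves_pos
    rcases leafWords_node_cases h with ⟨hlt, w, hw, rfl⟩ | ⟨j, w, hj, hw, rfl⟩
    · omega
    · have := hr hw (by omega)
      simp only [wordValue, wordWidth_cons, if_true]; linarith

/-- Consecutive leaf intervals are adjacent. -/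
theorem rightEnd_leaf_eq_wordValue_succ {t : FullBinaryTree} {i : ℕ} {u v : List Bool}
    (hu : t.leafWords[i]? = some u) (hv : t.leafWords[i + 1]? = some v) :
    wordValue u + wordWidth u = wordValue v := by
  induction t generalizing i u v with
  | nil => simp [leafWords] at hv
  | node _ l r hl hr =>
    rcases leafWords_node_cases hu with ⟨hlt, w, hw, rfl⟩ | ⟨j, w, hj, hw, rfl⟩ <;>
    rcases leafWords_node_cases hv with ⟨hlt', w', hw', rfl⟩ | ⟨j', w', hj', hw', rfl⟩
    · have := hl hw hw'
      simp only [wordValue, wordWidth_cons]; linarith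
    · obtain rfl : j' = 0 := by omega
      have h1 := rightEnd_leaf_last hw (by omega)
      have h2 := wordValue_leaf_zero hw'
      simp only [wordValue, wordWidth_cons, h2]; simp; linarith
    · omega
    · obtain rfl : j' = j + 1 := by omega
      have := hr hw hw'
      simp only [wordValue, wordWidth_cons]; linarith

theorem wordValue_leaf_lt {t : FullBinaryTree} {i j : ℕ} {u v : List Bool} (hij : i < j)
    (hu : t.leafWords[i]? = some u) (hv : t.leafWords[j]? = some v) :
    wordValue u < wordValue v := by
  obtain ⟨k, rfl⟩ := Nat.exists_eq_add_of_lt hij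
  clear hij
  induction k generalizing v with
  | zero => linarith [rightEnd_leaf_eq_wordValue_succ hu hv, wordWidth_pos u]
  | succ k ih =>
    have := lt_numLeaves_of_leafWords hv
    obtain ⟨w, hw⟩ := exists_leafWords_of_lt t (i := i + k + 1) (by omega)
    linarith [rightEnd_leaf_eq_wordValue_succ hw hv, wordWidth_pos w, ih hw]

theorem leaf_index_eq {t : FullBinaryTree} {i j : ℕ} {u v : List Bool}
    (hu : t.leafWords[i]? = some u) (hv : t.leafWords[j]? = some v)
    (h : wordValue u = wordValue v) : i = j := by
  rcases lt_trichotomy i j with hij | hij | hij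
  · exact absurd h (wordValue_leaf_lt hij hu hv).ne
  · exact hij
  · exact absurd h (wordValue_leaf_lt hij hv hu).ne'

/-- In cyclic order too, the right endpoint of a leaf interval is the left endpoint of the next. -/
theorem coe_rightEnd_leaf {t : FullBinaryTree} {i : ℕ} {u v : List Bool}
    (hu : t.leafWords[i]? = some u) (hv : t.leafWords[(i + 1) % t.numLeaves]? = some v) :
    ((wordValue u + wordWidth u : ℝ) : UnitAddCircle) = wordValue v := by
  have hi := lt_numLeaves_of_leafWords hu
  rcases Nat.lt_or_ge (i + 1) t.numLeaves with h | h
  · rw [Nat.mod_eq_of_lt h] at hv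
    rw [rightEnd_leaf_eq_wordValue_succ hu hv]
  · have h1 : i + 1 = t.numLeaves := by omega
    rw [h1, Nat.mod_self] at hv
    rw [wordValue_leaf_zero hv, rightEnd_leaf_last hu h1]
    exact UnitAddCircle.coe_eq_coe.2 ⟨1, by simp⟩

theorem CaretAt.exists_word {t : FullBinaryTree} {i : ℕ} (h : t.CaretAt i) :
    ∃ u, t.leafWords[i]? = some (u ++ [false]) ∧ t.leafWords[i + 1]? = some (u ++ [true]) := by
  induction t generalizing i with
  | nil => exact h.elim
  | node _ l r hl hr =>
    rcases h with ⟨rfl, rfl, rfl⟩ | h | ⟨i', rfl, h⟩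
    · exact ⟨[], rfl, rfl⟩
    · obtain ⟨u, h1, h2⟩ := hl h
      exact ⟨false :: u, leafWords_node_left h1, leafWords_node_left h2⟩
    · obtain ⟨u, h1, h2⟩ := hr h
      exact ⟨true :: u, leafWords_node_right h1, leafWords_node_right h2⟩

/-! ### Colourings of the Thompson graph of a tree -/

theorem exists_first_leaf (t : FullBinaryTree) :
    ∃ u, t.leafWords[0]? = some u ∧ digitParity u = 0 := by
  obtain ⟨u, hu⟩ := exists_leafWords_of_lt t t.numLeaves_pos
  exact ⟨u, hu, wordValue_eq_zero (wordValue_leaf_zero hu)⟩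

/-- The digit parity of the leaf addresses is a proper colouring of the Thompson graph. -/
theorem ThompsonEdge.exists_leaves {t : FullBinaryTree} {i j : ℕ} (h : t.ThompsonEdge i j) :
    ∃ u v, t.leafWords[i]? = some u ∧ t.leafWords[j]? = some v ∧
      digitParity v = digitParity u + 1 := by
  induction t generalizing i j with
  | nil => exact h.elim
  | node _ l r hl hr =>
    rcases h with ⟨rfl, rfl⟩ | h | ⟨i', j', rfl, rfl, h⟩
    · obtain ⟨u, hu, hu0⟩ := exists_first_leaf l
      obtain ⟨v, hv, hv0⟩ := exists_first_leaf r
      exact ⟨_, _, leafWords_node_left hu, leafWords_node_right (i := 0) hv,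
        by simp [digitParity, hu0, hv0]⟩
    · obtain ⟨u, v, h1, h2, h3⟩ := hl h
      exact ⟨_, _, leafWords_node_left h1, leafWords_node_left h2, by simp [digitParity, h3]⟩
    · obtain ⟨u, v, h1, h2, h3⟩ := hr h
      exact ⟨_, _, leafWords_node_right h1, leafWords_node_right h2,
        by simp [digitParity, h3, add_assoc]⟩

/-- The Thompson graph of a tree is connected, so its proper `2`-colourings agree with the digit
parity up to a constant. -/
theorem color_eq_digitParity {t : FullBinaryTree} {c : ℕ → ZMod 2}
    (hc : ∀ i j, t.ThompsonEdge i j → c j = c i + 1) {i : ℕ} {u : List Bool}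
    (hu : t.leafWords[i]? = some u) : c i = c 0 + digitParity u := by
  induction t generalizing c i u with
  | nil =>
    obtain rfl : i = 0 := by simpa using lt_numLeaves_of_leafWords hu
    simp [leafWords] at hu; simp [hu, digitParity]
  | node _ l r hl hr =>
    rcases leafWords_node_cases hu with ⟨-, w, hw, rfl⟩ | ⟨j, w, rfl, hw, rfl⟩
    · rw [hl (fun i j h => hc i j (Or.inr (Or.inl h))) hw]
      simp [digitParity]
    · have h1 := hr (c := fun j => c (l.numLeaves + j))
        (fun i j h => hc _ _ (Or.inr (Or.inr ⟨i, j, rfl, rfl, h⟩))) hw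
      simp only [add_zero] at h1
      rw [h1, hc 0 l.numLeaves (Or.inl ⟨rfl, rfl⟩)]
      simp [digitParity, add_assoc]

/-! ### The tree of maximal words with a property -/

/-- Bisecting as long as the property fails yields a tree whose leaves are maximal words. -/
theorem exists_tree_maximalWord (N : ℕ) (P : List Bool → Prop)
    (hP : ∀ u : List Bool, N ≤ u.length → P u) :
    ∃ t : FullBinaryTree, ∀ u ∈ t.leafWords, MaximalWord P u := by
  induction N generalizing P with
  | zero => exact ⟨.nil, by simp [leafWords, MaximalWord, hP]⟩
  | succ N ih =>
    by_cases h0 : P []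
    · exact ⟨.nil, by simp [leafWords, MaximalWord, h0]⟩
    · have key : ∀ d, ∃ t : FullBinaryTree, ∀ u ∈ t.leafWords, MaximalWord P (d :: u) := by
        intro d
        obtain ⟨t, ht⟩ := ih (fun u => P (d :: u)) fun u hu => hP _ (by simpa using hu)
        refine ⟨t, fun u hu => ⟨(ht u hu).1, fun w e hw => ?_⟩⟩
        cases w with
        | nil => exact h0
        | cons e' w =>
          simp only [List.cons_append, List.cons.injEq] at hw
          obtain ⟨rfl, hw⟩ := hw
          exact (ht u hu).2 w e hw
      obtain ⟨l, hl⟩ := key false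
      obtain ⟨r, hr⟩ := key true
      refine ⟨.node () l r, fun u hu => ?_⟩
      simp only [leafWords, List.mem_append, List.mem_map] at hu
      rcases hu with ⟨w, hw, rfl⟩ | ⟨w, hw, rfl⟩
      · exact hl w hw
      · exact hr w hw

/-- If the leaves of a tree are maximal for a property inherited by extensions, then every maximal
word is one of the leaves, because it is comparable with one of them. -/
theorem exists_leaf_of_maximalWord {P : List Bool → Prop} (hP : ∀ u w, P u → P (u ++ w))
    {t : FullBinaryTree} (ht : ∀ u ∈ t.leafWords, MaximalWord P u) {v : List Bool}
    (hv : MaximalWord P v) : ∃ i : ℕ, t.leafWords[i]? = some v := by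
  obtain ⟨i, k, r, w, hr, h⟩ := exists_leaf_prefix t v
  have hr' := ht r (List.mem_of_getElem? hr)
  refine ⟨i, ?_⟩
  rcases List.append_eq_append_iff.1 h with ⟨a, ha, -⟩ | ⟨a, ha, -⟩
  · subst ha
    have := hr'.eq_of_append hP hv.1
    simpa [this] using hr
  · subst ha
    have := hv.eq_of_append hP hr'.1
    simpa [this] using hr

end FullBinaryTree

/-! ### Standard dyadic intervals mapped linearly onto each other -/

/-- `f` maps the standard dyadic interval with address `u` linearly onto the one with address
`v`. -/
def MapsWord (f : UnitAddCircle → UnitAddCircle) (u v : List Bool) : Prop :=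
  ∀ t ∈ Ico (0 : ℝ) 1, f ((wordValue u + wordWidth u * t : ℝ) : UnitAddCircle) =
    ((wordValue v + wordWidth v * t : ℝ) : UnitAddCircle)

namespace MapsWord

variable {f : UnitAddCircle → UnitAddCircle} {u v v' : List Bool}

theorem append (h : MapsWord f u v) (w : List Bool) : MapsWord f (u ++ w) (v ++ w) := by
  intro t ht
  have e : ∀ z, wordValue (z ++ w) + wordWidth (z ++ w) * t =
      wordValue z + wordWidth z * (wordValue w + wordWidth w * t) := by
    intro z
    rw [wordValue_append, wordWidth_append]
    ring
  rw [e, e]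
  exact h _ (wordValue_add_mul_mem_Ico w ht)

theorem map_wordValue (h : MapsWord f u v) :
    f (wordValue u : UnitAddCircle) = (wordValue v : UnitAddCircle) := by
  simpa using h 0 (by simp)

theorem right_unique (h : MapsWord f u v) (h' : MapsWord f u v') : v = v' := by
  have key : ∀ t ∈ Ico (0 : ℝ) 1,
      wordValue v + wordWidth v * t = wordValue v' + wordWidth v' * t := fun t ht =>
    coe_inj_of_mem_Ico (wordValue_add_mul_mem_Ico v ht) (wordValue_add_mul_mem_Ico v' ht)
      ((h t ht).symm.trans (h' t ht))
  have h0 := key 0 (by simp)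
  have h1 := key (1 / 2) (by norm_num)
  exact eq_of_wordValue_eq (wordWidth_inj (by linarith)) (by linarith)

theorem inv {f : UnitAddCircle ≃ₜ UnitAddCircle} (h : MapsWord f u v) :
    MapsWord (f⁻¹ : UnitAddCircle ≃ₜ UnitAddCircle) v u := by
  intro t ht
  rw [← h t ht]
  exact f.symm_apply_apply _

/-- If both halves of an interval are mapped linearly onto the halves of another, then so is the
whole interval. -/
theorem of_halves (h0 : MapsWord f (u ++ [false]) (v ++ [false]))
    (h1 : MapsWord f (u ++ [true]) (v ++ [true])) : MapsWord f u v := by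
  intro t ht
  rcases lt_or_ge t (1 / 2) with h | h
  · have := h0 (2 * t) ⟨by linarith [ht.1], by linarith⟩
    have e : ∀ z, wordValue (z ++ [false]) + wordWidth (z ++ [false]) * (2 * t) =
        wordValue z + wordWidth z * t := by
      intro z
      simp [wordValue_append, wordWidth, wordValue]
      ring
    rwa [e, e] at this
  · have := h1 (2 * t - 1) ⟨by linarith, by linarith [ht.2]⟩
    have e : ∀ z, wordValue (z ++ [true]) + wordWidth (z ++ [true]) * (2 * t - 1) =
        wordValue z + wordWidth z * t := by
      intro z
      simp [wordValue_append, wordWidth, wordValue]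
      ring
    rwa [e, e] at this

theorem map_rightEnd (hf : Continuous f) (h : MapsWord f u v) :
    f ((wordValue u + wordWidth u : ℝ) : UnitAddCircle) =
      ((wordValue v + wordWidth v : ℝ) : UnitAddCircle) := by
  have hq : Continuous ((↑) : ℝ → UnitAddCircle) := AddCircle.continuous_mk' 1
  have h1 : EqOn (fun t : ℝ => f ((wordValue u + wordWidth u * t : ℝ) : UnitAddCircle))
      (fun t : ℝ => ((wordValue v + wordWidth v * t : ℝ) : UnitAddCircle))
      (closure (Ico (0 : ℝ) 1)) :=
    EqOn.closure h (hf.comp (hq.comp (by fun_prop))) (hq.comp (by fun_prop))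
  rw [closure_Ico (by norm_num)] at h1
  simpa using h1 (x := 1) (by simp)

end MapsWord

/-- A point of `(1 / 2 ^ n) ℤ` does not lie inside a standard dyadic interval of length
`1 / 2 ^ n`. -/
theorem not_mem_Ioo_of_coe_eq {u : List Bool} {x : ℝ} {m : ℤ}
    (h : (x : UnitAddCircle) = ((m / 2 ^ u.length : ℝ) : UnitAddCircle)) :
    x ∉ Ioo (wordValue u) (wordValue u + wordWidth u) := by
  rintro ⟨h1, h2⟩
  obtain ⟨a, ha⟩ := exists_natCast_eq_wordValue_mul u
  obtain ⟨j, hj⟩ := UnitAddCircle.coe_eq_coe.1 h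
  have hw : wordWidth u = 1 / 2 ^ u.length := by simp [wordWidth]
  have hp : (0 : ℝ) < 2 ^ u.length := by positivity
  rw [ha, hj] at h1
  rw [ha, hj, hw] at h2
  have e : (m / 2 ^ u.length + j : ℝ) = (m + j * 2 ^ u.length) / 2 ^ u.length := by field_simp
  rw [e, div_lt_div_iff_of_pos_right hp] at h1
  rw [e, ← add_div, div_lt_div_iff_of_pos_right hp] at h2
  have h1' : (a : ℤ) < m + j * 2 ^ u.length := by exact_mod_cast h1
  have h2' : m + j * 2 ^ u.length < (a : ℤ) + 1 := by exact_mod_cast h2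
  omega

/-- A map of the form `x ↦ 2 ^ k * x + c` with dyadic `c` on a standard dyadic interval maps all
sufficiently short standard dyadic subintervals linearly onto standard dyadic intervals. -/
theorem exists_mapsWord_append_of_affine {f : UnitAddCircle → UnitAddCircle} {u : List Bool}
    {k : ℤ} {c : ℝ} (hc : IsDyadic c)
    (h : ∀ x ∈ Ico (wordValue u) (wordValue u + wordWidth u),
      f (x : UnitAddCircle) = ((2 ^ k * x + c : ℝ) : UnitAddCircle)) :
    ∃ N : ℕ, ∀ w : List Bool, N ≤ w.length → ∃ v, MapsWord f (u ++ w) v := by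
  obtain ⟨M, b, rfl⟩ := hc
  refine ⟨b + k.toNat, fun w hw => ?_⟩
  obtain ⟨a, ha⟩ := exists_natCast_eq_wordValue_mul (u ++ w)
  set n := (u ++ w).length with hn
  have hn' : n = u.length + w.length := by simp [hn]
  -- the image intervals have length `2 ^ (-L)`, and their endpoints have denominator `2 ^ L`
  obtain ⟨L, hL⟩ : ∃ L : ℕ, (L : ℤ) = n - k := ⟨(n - k).toNat, by omega⟩
  have hbL : b ≤ L := by omega
  obtain ⟨d, rfl⟩ := Nat.exists_eq_add_of_le hbL
  obtain ⟨v, hvl, hv⟩ := exists_coe_wordValue_eq_intCast_div (b + d) (a + M * 2 ^ d)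
  refine ⟨v, fun t ht => ?_⟩
  have hk : (2 : ℝ) ^ k = 2 ^ n / 2 ^ (b + d) := by
    rw [show k = (n : ℤ) - ((b + d : ℕ) : ℤ) by omega, zpow_sub₀ (by norm_num), zpow_natCast,
      zpow_natCast]
  have hmem : wordValue (u ++ w) + wordWidth (u ++ w) * t ∈
      Ico (wordValue u) (wordValue u + wordWidth u) := by
    have h1 := wordValue_add_mul_mem_Ico w ht
    have h2 := wordWidth_pos u
    rw [wordValue_append, wordWidth_append]
    constructor
    · nlinarith [h1.1]
    · nlinarith [h1.2]
  rw [h _ hmem, AddCircle.coe_add _ (wordValue v), hv, ← AddCircle.coe_add]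
  congr 1
  rw [hk, ha]
  simp only [wordWidth, hvl, ← hn, one_div, inv_pow]
  push_cast
  field_simp
  ring

/-- An element of `T` maps all sufficiently short standard dyadic intervals linearly onto standard
dyadic intervals. -/
theorem IsThompson.exists_mapsWord {f : UnitAddCircle ≃ₜ UnitAddCircle} (hf : IsThompson f) :
    ∃ N : ℕ, ∀ u : List Bool, N ≤ u.length → ∃ v, MapsWord f u v := by
  obtain ⟨B, hB, h⟩ := hf
  -- a common denominator `2 ^ n` of the break points
  have h1 : ∀ p : UnitAddCircle, ∃ n : ℕ, p ∈ B →
      ∃ m : ℤ, p = ((m / 2 ^ n : ℝ) : UnitAddCircle) := by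
    intro p
    by_cases hp : p ∈ B
    · obtain ⟨x, ⟨m, n, rfl⟩, rfl⟩ := hB p hp
      exact ⟨n, fun _ => ⟨m, rfl⟩⟩
    · exact ⟨0, fun h => absurd h hp⟩
  choose ν hν using h1
  set n := B.sup ν
  have h2 : ∀ p ∈ B, ∃ m : ℤ, p = ((m / 2 ^ n : ℝ) : UnitAddCircle) := by
    intro p hp
    obtain ⟨m, hm⟩ := hν p hp
    obtain ⟨d, hd⟩ := Nat.exists_eq_add_of_le (Finset.le_sup (f := ν) hp)
    refine ⟨m * 2 ^ d, hm.trans ?_⟩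
    congr 1
    change _ = _ / 2 ^ (B.sup ν)
    rw [hd]
    push_cast
    rw [pow_add]
    field_simp
  -- no break point lies inside a standard dyadic interval of length `1 / 2 ^ n`
  have h3 : ∀ u : List Bool, ∃ N : ℕ, u.length = n →
      ∀ w : List Bool, N ≤ w.length → ∃ v, MapsWord f (u ++ w) v := by
    intro u
    by_cases hu : u.length = n
    · obtain ⟨k, c, hc, hk⟩ := h (wordValue u) (wordValue u + wordWidth u) fun x hx hxB => by
        obtain ⟨m, hm⟩ := h2 _ hxB
        rw [← hu] at hm
        exact not_mem_Ioo_of_coe_eq hm hx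
      have hq : Continuous ((↑) : ℝ → UnitAddCircle) := AddCircle.continuous_mk' 1
      have hcl : EqOn (fun x : ℝ => f (x : UnitAddCircle))
          (fun x : ℝ => ((2 ^ k * x + c : ℝ) : UnitAddCircle))
          (closure (Ioo (wordValue u) (wordValue u + wordWidth u))) :=
        EqOn.closure hk (f.continuous.comp hq) (hq.comp (by fun_prop))
      rw [closure_Ioo (by linarith [wordWidth_pos u])] at hcl
      obtain ⟨N, hN⟩ := exists_mapsWord_append_of_affine hc fun x hx =>
        hcl (Ico_subset_Icc_self hx)
      exact ⟨N, fun _ => hN⟩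
    · exact ⟨0, fun h => absurd h hu⟩
  choose μ hμ using h3
  have hfin : {u : List Bool | u.length = n}.Finite := List.finite_length_eq Bool n
  refine ⟨n + hfin.toFinset.sup μ, fun u hu => ?_⟩
  have hl : (u.take n).length = n := by simp; omega
  have := hμ (u.take n) hl (u.drop n) <| by
    have := Finset.le_sup (f := μ) (hfin.mem_toFinset.2 (show u.take n ∈ _ from hl))
    simp
    omega
  rwa [List.take_append_drop] at this

theorem IsThompson.exists_wordValue_eq {f : UnitAddCircle ≃ₜ UnitAddCircle} (hf : IsThompson f)
    (u : List Bool) :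
    ∃ v : List Bool, f (wordValue u : UnitAddCircle) = (wordValue v : UnitAddCircle) := by
  obtain ⟨y, hy, h⟩ := hf.inv.1.inv.2 _ (isDyadic_wordValue u)
  obtain ⟨v, hv⟩ := hy.exists_wordValue
  rw [inv_inv] at h
  exact ⟨v, h.trans hv.symm⟩

/-! ### Reduced diagrams -/

namespace TreeDiagram

theorem represents_iff {D : TreeDiagram} {f : UnitAddCircle → UnitAddCircle} :
    D.Represents f ↔ ∀ (i : ℕ) (u v : List Bool), D.R.leafWords[i]? = some u →
      D.S.leafWords[D.leafMatch i]? = some v → MapsWord f u v := by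
  constructor
  · intro h i u v hu hv t ht
    have hp := wordWidth_pos u
    have := h i _ _ (by rw [FullBinaryTree.leafIntervals_eq_map, List.getElem?_map, hu]; rfl)
      (by rw [FullBinaryTree.leafIntervals_eq_map, List.getElem?_map, hv]; rfl)
      (wordValue u + wordWidth u * t) (by
        simp only [sub_zero, zero_add, one_mul]
        exact ⟨by nlinarith [ht.1], by nlinarith [ht.2]⟩)
    rw [this]
    congr 1
    simp only [sub_zero, zero_add, one_mul, add_sub_cancel_left]
    field_simp
  · intro h i I J hI hJ x hx
    rw [FullBinaryTree.leafIntervals_eq_map, List.getElem?_map, Option.map_eq_some_iff] at hI hJ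
    obtain ⟨u, hu, rfl⟩ := hI
    obtain ⟨v, hv, rfl⟩ := hJ
    have hp := wordWidth_pos u
    simp only [sub_zero, zero_add, one_mul] at hx
    simp only [sub_zero, zero_add, one_mul, add_sub_cancel_left]
    have := h i u v hu hv ((x - wordValue u) / wordWidth u)
      ⟨div_nonneg (by linarith [hx.1]) hp.le, by rw [div_lt_one hp]; linarith [hx.2]⟩
    rw [mul_div_cancel₀ _ hp.ne', add_sub_cancel] at this
    rw [this]
    congr 1
    ring

theorem leafMatch_lt (D : TreeDiagram) (i : ℕ) : D.leafMatch i < D.R.numLeaves :=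
  Nat.mod_lt _ D.R.numLeaves_pos

theorem exists_leafMatch_eq (D : TreeDiagram) {j : ℕ} (hj : j < D.R.numLeaves) :
    ∃ i < D.R.numLeaves, D.leafMatch i = j := by
  refine ⟨(j + (D.R.numLeaves - D.shift)) % D.R.numLeaves, Nat.mod_lt _ D.R.numLeaves_pos, ?_⟩
  have := D.shift_lt
  rw [leafMatch, Nat.mod_add_mod, show j + (D.R.numLeaves - D.shift) + D.shift
    = j + D.R.numLeaves by omega, Nat.add_mod_right, Nat.mod_eq_of_lt hj]

theorem exists_leaf_leafMatch (D : TreeDiagram) (i : ℕ) :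
    ∃ v, D.S.leafWords[D.leafMatch i]? = some v :=
  D.S.exists_leafWords_of_lt (D.numLeaves_eq ▸ D.leafMatch_lt i)

theorem leafMatch_inj (D : TreeDiagram) {i j : ℕ} (hi : i < D.R.numLeaves)
    (hj : j < D.R.numLeaves) (h : D.leafMatch i = D.leafMatch j) : i = j := by
  have : i % D.R.numLeaves = j % D.R.numLeaves := Nat.ModEq.add_right_cancel' D.shift h
  rwa [Nat.mod_eq_of_lt hi, Nat.mod_eq_of_lt hj] at this

end TreeDiagram

/-- The maximal standard dyadic intervals which `f` maps linearly onto such intervals are mapped to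
those of the inverse of `f`. -/
theorem MaximalWord.map {f : UnitAddCircle ≃ₜ UnitAddCircle} {u v : List Bool}
    (hu : MaximalWord (fun u => ∃ v, MapsWord f u v) u) (h : MapsWord f u v) :
    MaximalWord (fun v => ∃ u, MapsWord (f⁻¹ : UnitAddCircle ≃ₜ UnitAddCircle) v u) v := by
  refine ⟨⟨u, h.inv⟩, ?_⟩
  rintro w d rfl ⟨u', hu'⟩
  obtain rfl := (hu'.append [d]).right_unique h.inv
  have := hu'.inv
  rw [inv_inv] at this
  exact hu.2 u' d rfl ⟨w, this⟩

/-- Two trees whose leaf intervals are mapped linearly onto each other by a homeomorphism of the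
circle have equally many leaves, and the leaves are matched by a cyclic shift. -/
theorem leaves_cyclically_matched {f : UnitAddCircle ≃ₜ UnitAddCircle} {R S : FullBinaryTree}
    (hRS : ∀ (i : ℕ) (u : List Bool), R.leafWords[i]? = some u →
      ∃ (j : ℕ) (v : List Bool), S.leafWords[j]? = some v ∧ MapsWord f u v)
    (hSR : ∀ (j : ℕ) (v : List Bool), S.leafWords[j]? = some v →
      ∃ (i : ℕ) (u : List Bool), R.leafWords[i]? = some u ∧ MapsWord f u v) :
    S.numLeaves = R.numLeaves ∧ ∃ s < R.numLeaves, ∀ (i : ℕ) (u v : List Bool),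
      R.leafWords[i]? = some u → S.leafWords[(i + s) % R.numLeaves]? = some v →
        MapsWord f u v := by
  have key : ∀ i : Fin R.numLeaves, ∃ j : Fin S.numLeaves, ∃ u v : List Bool,
      R.leafWords[(i : ℕ)]? = some u ∧ S.leafWords[(j : ℕ)]? = some v ∧ MapsWord f u v := by
    intro i
    obtain ⟨u, hu⟩ := R.exists_leafWords_of_lt i.2
    obtain ⟨j, v, hv, h⟩ := hRS i u hu
    exact ⟨⟨j, FullBinaryTree.lt_numLeaves_of_leafWords hv⟩, u, v, hu, hv, h⟩
  choose σ U W hU hW hUW using key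
  have inj : Function.Injective σ := by
    intro i i' h
    have hw : W i = W i' := by
      have h1 := hW i
      rw [h, hW i'] at h1
      exact (Option.some.inj h1).symm
    have h2 := (hUW i).inv
    rw [hw] at h2
    have h3 := h2.right_unique (hUW i').inv
    exact Fin.ext (FullBinaryTree.leaf_index_eq (hU i) (hU i') (by rw [h3]))
  have surj : Function.Surjective σ := by
    intro j
    obtain ⟨v, hv⟩ := S.exists_leafWords_of_lt j.2
    obtain ⟨i, u, hu, h⟩ := hSR j v hv
    let i' : Fin R.numLeaves := ⟨i, FullBinaryTree.lt_numLeaves_of_leafWords hu⟩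
    refine ⟨i', Fin.ext ?_⟩
    have h1 : U i' = u := Option.some.inj ((hU i').symm.trans hu)
    have h2 := hUW i'
    rw [h1] at h2
    exact FullBinaryTree.leaf_index_eq (hW i') hv (by rw [h2.right_unique h])
  have hcard : S.numLeaves = R.numLeaves := by
    simpa using (Fintype.card_of_bijective ⟨inj, surj⟩).symm
  have hpos := R.numLeaves_pos
  have hlt : (σ ⟨0, hpos⟩ : ℕ) < R.numLeaves := (σ ⟨0, hpos⟩).2.trans_eq hcard
  -- the image of the right endpoint of a leaf interval is computed in two ways
  have succ : ∀ i : Fin R.numLeaves,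
      (σ ⟨(i + 1) % R.numLeaves, Nat.mod_lt _ hpos⟩ : ℕ) = (σ i + 1) % R.numLeaves := by
    intro i
    set i' : Fin R.numLeaves := ⟨(i + 1) % R.numLeaves, Nat.mod_lt _ hpos⟩
    obtain ⟨v, hv⟩ := S.exists_leafWords_of_lt (i := (σ i + 1) % S.numLeaves)
      (Nat.mod_lt _ S.numLeaves_pos)
    have h1 := FullBinaryTree.coe_rightEnd_leaf (hU i) (hU i')
    have h2 := FullBinaryTree.coe_rightEnd_leaf (hW i) hv
    have h3 := (hUW i).map_rightEnd f.continuous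
    rw [h1, h2, (hUW i').map_wordValue] at h3
    rw [← hcard]
    exact FullBinaryTree.leaf_index_eq (hW i') hv
      (coe_inj_of_mem_Ico (wordValue_mem_Ico _) (wordValue_mem_Ico _) h3)
  have shift : ∀ (i : ℕ) (hi : i < R.numLeaves),
      (σ ⟨i, hi⟩ : ℕ) = (i + σ ⟨0, hpos⟩) % R.numLeaves := by
    intro i hi
    induction i with
    | zero => rw [zero_add, Nat.mod_eq_of_lt hlt]
    | succ i ih =>
      have h1 := succ ⟨i, by omega⟩
      simp only [Nat.mod_eq_of_lt hi] at h1
      rw [h1, ih, Nat.mod_add_mod]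
      congr 1
      omega
  refine ⟨hcard, σ ⟨0, hpos⟩, hlt, fun i u v hu hv => ?_⟩
  have hi := FullBinaryTree.lt_numLeaves_of_leafWords hu
  rw [← shift i hi] at hv
  have h1 : U ⟨i, hi⟩ = u := Option.some.inj ((hU ⟨i, hi⟩).symm.trans hu)
  have h2 : W ⟨i, hi⟩ = v := Option.some.inj ((hW ⟨i, hi⟩).symm.trans hv)
  exact h1 ▸ h2 ▸ hUW ⟨i, hi⟩

/-- Every element of `T` has a reduced tree diagram: its input tree is cut out by the maximal
standard dyadic intervals mapped linearly onto such intervals, and its output tree by those of the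
inverse. -/
theorem IsThompson.exists_reduced_diagram {f : UnitAddCircle ≃ₜ UnitAddCircle}
    (hf : IsThompson f) : ∃ D : TreeDiagram, D.Represents f ∧ D.IsReduced := by
  obtain ⟨N, hN⟩ := hf.exists_mapsWord
  obtain ⟨N', hN'⟩ := hf.inv.1.exists_mapsWord
  obtain ⟨R, hR⟩ := FullBinaryTree.exists_tree_maximalWord N _ hN
  obtain ⟨S, hS⟩ := FullBinaryTree.exists_tree_maximalWord N' _ hN'
  have hRS : ∀ (i : ℕ) (u : List Bool), R.leafWords[i]? = some u →
      ∃ (j : ℕ) (v : List Bool), S.leafWords[j]? = some v ∧ MapsWord f u v := by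
    intro i u hu
    have hm := hR u (List.mem_of_getElem? hu)
    obtain ⟨v, hv⟩ := hm.1
    obtain ⟨j, hj⟩ := FullBinaryTree.exists_leaf_of_maximalWord
      (fun u w ⟨v, hv⟩ => ⟨v ++ w, hv.append w⟩) hS (MaximalWord.map hm hv)
    exact ⟨j, v, hj, hv⟩
  have hSR : ∀ (j : ℕ) (v : List Bool), S.leafWords[j]? = some v →
      ∃ (i : ℕ) (u : List Bool), R.leafWords[i]? = some u ∧ MapsWord f u v := by
    intro j v hv
    have hm := hS v (List.mem_of_getElem? hv)
    obtain ⟨u, hu⟩ := hm.1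
    have hm' := MaximalWord.map hm hu
    have hu' := hu.inv
    rw [inv_inv] at hm' hu'
    obtain ⟨i, hi⟩ := FullBinaryTree.exists_leaf_of_maximalWord
      (fun u w ⟨v, hv⟩ => ⟨v ++ w, hv.append w⟩) hR hm'
    exact ⟨i, u, hi, hu'⟩
  obtain ⟨hcard, s, hs, h⟩ := leaves_cyclically_matched hRS hSR
  let D : TreeDiagram := ⟨R, S, s, hcard, hs⟩
  refine ⟨D, TreeDiagram.represents_iff.2 h, fun i ⟨h1, h2⟩ => ?_⟩
  -- a dipole joins two leaves of `R` to a longer interval mapped linearly, against maximality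
  obtain ⟨u, hu0, hu1⟩ := h1.exists_word
  obtain ⟨v, hv0, hv1⟩ := h2.exists_word
  have hlt : D.leafMatch i + 1 < R.numLeaves := by
    have := FullBinaryTree.lt_numLeaves_of_leafWords hv1
    rwa [D.numLeaves_eq] at this
  have hmatch : (i + 1 + s) % R.numLeaves = D.leafMatch i + 1 := by
    rw [← Nat.mod_eq_of_lt hlt]
    simp only [TreeDiagram.leafMatch, D, Nat.mod_add_mod]
    congr 1
    omega
  have m0 := h i _ _ hu0 hv0
  have m1 := h (i + 1) _ _ hu1 (by rw [hmatch]; exact hv1)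
  exact (hR _ (List.mem_of_getElem? hu0)).2 u false rfl ⟨v, m0.of_halves m1⟩

/-! ### The stabilizer of the parity -/

theorem ZMod.two_eq_add_one_of_ne {a b : ZMod 2} (h : a ≠ b) : b = a + 1 := by
  revert a b; decide

/-- The elements of `T` that preserve or reverse the parity of the sum of the binary digits of
dyadic numbers. The dyadic points of the circle are written as values of words; the parity does not
depend on the word chosen. -/
def parityStabilizer : Subgroup thompsonT where
  carrier := {f | ∃ c : ZMod 2, ∀ u v : List Bool,
    (f : UnitAddCircle ≃ₜ UnitAddCircle) (wordValue u : UnitAddCircle) = wordValue v →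
      digitParity v = digitParity u + c}
  one_mem' := ⟨0, fun u v h => by rw [add_zero]; exact (digitParity_eq_of_coe_eq h).symm⟩
  mul_mem' := by
    rintro g f ⟨c, hc⟩ ⟨d, hd⟩
    refine ⟨d + c, fun u v h => ?_⟩
    obtain ⟨w, hw⟩ := IsThompson.exists_wordValue_eq f.2 u
    have h1 : (g : UnitAddCircle ≃ₜ UnitAddCircle) (wordValue w : UnitAddCircle) = wordValue v := by
      rw [← hw]; exact h
    rw [hc w v h1, hd u w hw, add_assoc]
  inv_mem' := by
    rintro f ⟨c, hc⟩
    refine ⟨-c, fun u v h => ?_⟩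
    have h1 : (f : UnitAddCircle ≃ₜ UnitAddCircle) (wordValue v : UnitAddCircle) = wordValue u := by
      rw [← h]
      exact (f : UnitAddCircle ≃ₜ UnitAddCircle).apply_symm_apply _
    rw [hc v u h1]
    ring

namespace TreeDiagram

/-- The Thompson graph is bipartite if and only if the digit parities of identified leaves differ by
a constant. -/
theorem isBipartite_thompsonGraph_iff (D : TreeDiagram) :
    D.thompsonGraph.IsBipartite ↔ ∃ c : ZMod 2, ∀ (i : ℕ) (u v : List Bool),
      D.R.leafWords[i]? = some u → D.S.leafWords[D.leafMatch i]? = some v →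
        digitParity v = digitParity u + c := by
  constructor
  · rintro ⟨C⟩
    obtain ⟨c, hc⟩ : ∃ c : ℕ → ZMod 2, ∀ i : Fin D.R.numLeaves, c i = C i :=
      ⟨fun i => if h : i < D.R.numLeaves then C ⟨i, h⟩ else 0, fun i => dif_pos i.2⟩
    have adj : ∀ i j, i < D.R.numLeaves → j < D.R.numLeaves → i ≠ j →
        (D.R.ThompsonEdge i j ∨ D.S.ThompsonEdge (D.leafMatch i) (D.leafMatch j)) →
        c j = c i + 1 := by
      intro i j hi hj hij h
      have h1 : D.thompsonGraph.Adj ⟨i, hi⟩ ⟨j, hj⟩ :=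
        (SimpleGraph.fromRel_adj _ _ _).2 ⟨fun h => hij (congrArg Fin.val h), Or.inl h⟩
      rw [show c i = C ⟨i, hi⟩ from hc ⟨i, hi⟩, show c j = C ⟨j, hj⟩ from hc ⟨j, hj⟩]
      exact ZMod.two_eq_add_one_of_ne (C.valid h1)
    have hR : ∀ i j, D.R.ThompsonEdge i j → c j = c i + 1 := by
      intro i j h
      obtain ⟨u, v, hu, hv, huv⟩ := h.exists_leaves
      refine adj i j (FullBinaryTree.lt_numLeaves_of_leafWords hu)
        (FullBinaryTree.lt_numLeaves_of_leafWords hv) ?_ (Or.inl h)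
      rintro rfl
      rw [hu, Option.some.injEq] at hv
      simp [hv] at huv
    -- `τ` numbers the leaves of the output tree by the identified leaves of the input tree
    have hτ : ∀ j, ∃ i, j < D.R.numLeaves → i < D.R.numLeaves ∧ D.leafMatch i = j := by
      intro j
      by_cases hj : j < D.R.numLeaves
      · obtain ⟨i, hi⟩ := D.exists_leafMatch_eq hj
        exact ⟨i, fun _ => hi⟩
      · exact ⟨0, fun h => absurd h hj⟩
    choose τ hτ using hτ
    have hS : ∀ i j, D.S.ThompsonEdge i j → c (τ j) = c (τ i) + 1 := by
      intro i j h
      obtain ⟨u, v, hu, hv, huv⟩ := h.exists_leaves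
      have hi := hτ i (D.numLeaves_eq ▸ FullBinaryTree.lt_numLeaves_of_leafWords hu)
      have hj := hτ j (D.numLeaves_eq ▸ FullBinaryTree.lt_numLeaves_of_leafWords hv)
      refine adj _ _ hi.1 hj.1 ?_ (Or.inr (by rwa [hi.2, hj.2]))
      intro hij
      have : i = j := by rw [← hi.2, hij, hj.2]
      subst this
      rw [hu, Option.some.injEq] at hv
      simp [hv] at huv
    refine ⟨c 0 - c (τ 0), fun i u v hu hv => ?_⟩
    have h1 := FullBinaryTree.color_eq_digitParity hR hu
    have h2 := FullBinaryTree.color_eq_digitParity (c := fun j => c (τ j)) hS hv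
    have h3 := hτ _ (D.leafMatch_lt i)
    simp only [D.leafMatch_inj h3.1 (FullBinaryTree.lt_numLeaves_of_leafWords hu) h3.2] at h2
    rw [h1] at h2
    linear_combination -h2
  · rintro ⟨c, hc⟩
    have hU : ∀ i : Fin D.R.numLeaves, ∃ u, D.R.leafWords[(i : ℕ)]? = some u := fun i =>
      D.R.exists_leafWords_of_lt i.2
    choose U hU using hU
    have edge : ∀ i j : Fin D.R.numLeaves, (D.R.ThompsonEdge i j ∨
        D.S.ThompsonEdge (D.leafMatch i) (D.leafMatch j)) →
        digitParity (U i) ≠ digitParity (U j) := by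
      intro i j h
      rcases h with h | h
      · obtain ⟨u, v, hu, hv, huv⟩ := h.exists_leaves
        rw [hU, Option.some.injEq] at hu hv
        rw [hu, hv, huv]
        simp
      · obtain ⟨u, v, hu, hv, huv⟩ := h.exists_leaves
        rw [hc i _ _ (hU i) hu, hc j _ _ (hU j) hv] at huv
        intro h
        rw [h] at huv
        simp at huv
    exact ⟨SimpleGraph.Coloring.mk (fun i => (digitParity (U i) : ZMod 2)) fun {i j} h => by
      rcases ((SimpleGraph.fromRel_adj _ _ _).1 h).2 with h | h
      · exact edge i j h
      · exact (edge j i h).symm⟩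

end TreeDiagram

/-- A word `u`, padded with zeros, runs through a leaf `r` of the input tree, say `u = r w`; the
corresponding value is `s w` with the identified leaf `s` of the output tree. So the change of
parity at `u` is the change of parity between `r` and `s`. -/
theorem parityStabilizer_eq_jonesSet : (parityStabilizer : Set thompsonT) = jonesSet := by
  ext f
  constructor
  · rintro ⟨c, hc⟩
    obtain ⟨D, hD, hred⟩ := IsThompson.exists_reduced_diagram f.2
    refine ⟨D, hD, hred, D.isBipartite_thompsonGraph_iff.2 ⟨c, fun i u v hu hv => ?_⟩⟩
    exact hc u v (TreeDiagram.represents_iff.1 hD i u v hu hv).map_wordValue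
  · rintro ⟨D, hD, -, hbip⟩
    obtain ⟨c, hc⟩ := D.isBipartite_thompsonGraph_iff.1 hbip
    refine ⟨c, fun u v huv => ?_⟩
    obtain ⟨i, k, r, w, hr, h⟩ := D.R.exists_leaf_prefix u
    obtain ⟨s, hs⟩ := D.exists_leaf_leafMatch i
    have h1 := ((TreeDiagram.represents_iff.1 hD i r s hr hs).append w).map_wordValue
    rw [← h, wordValue_append_replicate_false, huv] at h1
    rw [digitParity_eq_of_coe_eq h1, digitParity_append, hc i r s hr hs,
      ← digitParity_append_replicate_false u k, h, digitParity_append]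
    ring

/-! ### An element that contracts the circle towards one point -/

theorem UnitAddCircle.exists_mem_Ico (p : UnitAddCircle) :
    ∃ x ∈ Ico (0 : ℝ) 1, (x : UnitAddCircle) = p := by
  obtain ⟨y, rfl⟩ := QuotientAddGroup.mk_surjective p
  refine ⟨Int.fract y, ⟨Int.fract_nonneg y, Int.fract_lt_one y⟩, ?_⟩
  exact UnitAddCircle.coe_eq_coe.2 ⟨-⌊y⌋, by push_cast; rw [Int.fract]; ring⟩

/-- A piecewise linear map of `[0, 1]` onto itself which moves all points but `0` and `1` to the
left. In terms of binary expansions it replaces the prefixes `0`, `10`, `110`, `111` by `00`, `010`,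
`011`, `1`; these replacements do not change the parity of the sum of digits. -/
noncomputable def contractionFun (x : ℝ) : ℝ := max (x / 2) (max (x - 3 / 8) (4 * x - 3))

/-- The inverse of `contractionFun`. -/
noncomputable def contractionInvFun (x : ℝ) : ℝ := min (2 * x) (min (x + 3 / 8) (x / 4 + 3 / 4))

theorem contractionFun_of_le {x : ℝ} (h : x ≤ 3 / 4) : contractionFun x = x / 2 := by
  rw [contractionFun, max_eq_left]
  exact max_le (by linarith) (by linarith)

theorem contractionFun_of_mem {x : ℝ} (h : 3 / 4 ≤ x) (h' : x ≤ 7 / 8) :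
    contractionFun x = x - 3 / 8 := by
  rw [contractionFun, max_eq_left (a := x - 3 / 8) (by linarith), max_eq_right (by linarith)]

theorem contractionFun_of_ge {x : ℝ} (h : 7 / 8 ≤ x) : contractionFun x = 4 * x - 3 := by
  rw [contractionFun, max_eq_right (b := 4 * x - 3) (by linarith), max_eq_right (by linarith)]

theorem contractionInvFun_of_le {x : ℝ} (h : x ≤ 3 / 8) : contractionInvFun x = 2 * x := by
  rw [contractionInvFun, min_eq_left]
  exact le_min (by linarith) (by linarith)

theorem contractionInvFun_of_mem {x : ℝ} (h : 3 / 8 ≤ x) (h' : x ≤ 1 / 2) :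
    contractionInvFun x = x + 3 / 8 := by
  rw [contractionInvFun, min_eq_left (a := x + 3 / 8) (by linarith), min_eq_right (by linarith)]

theorem contractionInvFun_of_ge {x : ℝ} (h : 1 / 2 ≤ x) : contractionInvFun x = x / 4 + 3 / 4 := by
  rw [contractionInvFun, min_eq_right (b := x / 4 + 3 / 4) (by linarith),
    min_eq_right (by linarith)]

theorem contractionFun_mem_Ico {x : ℝ} (hx : x ∈ Ico (0 : ℝ) 1) :
    contractionFun x ∈ Ico (0 : ℝ) 1 := by
  obtain ⟨h0, h1⟩ := hx
  exact ⟨le_max_of_le_left (by linarith),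
    max_lt (by linarith) (max_lt (by linarith) (by linarith))⟩

theorem contractionInvFun_mem_Ico {x : ℝ} (hx : x ∈ Ico (0 : ℝ) 1) :
    contractionInvFun x ∈ Ico (0 : ℝ) 1 := by
  obtain ⟨h0, h1⟩ := hx
  exact ⟨le_min (by linarith) (le_min (by linarith) (by linarith)),
    min_lt_of_right_lt (min_lt_of_right_lt (by linarith))⟩

theorem contractionInvFun_contractionFun (x : ℝ) :
    contractionInvFun (contractionFun x) = x := by
  rcases le_total x (3 / 4) with h | h
  · rw [contractionFun_of_le h, contractionInvFun_of_le (by linarith)]; ring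
  rcases le_total x (7 / 8) with h' | h'
  · rw [contractionFun_of_mem h h', contractionInvFun_of_mem (by linarith) (by linarith)]; ring
  · rw [contractionFun_of_ge h', contractionInvFun_of_ge (by linarith)]; ring

theorem contractionFun_contractionInvFun (x : ℝ) :
    contractionFun (contractionInvFun x) = x := by
  rcases le_total x (3 / 8) with h | h
  · rw [contractionInvFun_of_le h, contractionFun_of_le (by linarith)]; ring
  rcases le_total x (1 / 2) with h' | h'
  · rw [contractionInvFun_of_mem h h', contractionFun_of_mem (by linarith) (by linarith)]; ring
  · rw [contractionInvFun_of_ge h', contractionFun_of_ge (by linarith)]; ring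

/-- The homeomorphism of the circle induced by `contractionFun`. -/
noncomputable def contraction : UnitAddCircle ≃ₜ UnitAddCircle where
  toFun := AddCircle.liftIco 1 0 fun x => (contractionFun x : UnitAddCircle)
  invFun := AddCircle.liftIco 1 0 fun x => (contractionInvFun x : UnitAddCircle)
  left_inv p := by
    obtain ⟨x, hx, rfl⟩ := UnitAddCircle.exists_mem_Ico p
    rw [AddCircle.liftIco_zero_coe_apply hx,
      AddCircle.liftIco_zero_coe_apply (contractionFun_mem_Ico hx),
      contractionInvFun_contractionFun]
  right_inv p := by
    obtain ⟨x, hx, rfl⟩ := UnitAddCircle.exists_mem_Ico p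
    rw [AddCircle.liftIco_zero_coe_apply hx,
      AddCircle.liftIco_zero_coe_apply (contractionInvFun_mem_Ico hx),
      contractionFun_contractionInvFun]
  continuous_toFun := by
    refine AddCircle.liftIco_zero_continuous (UnitAddCircle.coe_eq_coe.2 ⟨-1, ?_⟩) ?_
    · rw [contractionFun_of_le (by norm_num), contractionFun_of_ge (by norm_num)]; norm_num
    · refine ((AddCircle.continuous_mk' 1).comp ?_).continuousOn
      unfold contractionFun
      fun_prop
  continuous_invFun := by
    refine AddCircle.liftIco_zero_continuous (UnitAddCircle.coe_eq_coe.2 ⟨-1, ?_⟩) ?_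
    · rw [contractionInvFun_of_le (by norm_num), contractionInvFun_of_ge (by norm_num)]; norm_num
    · refine ((AddCircle.continuous_mk' 1).comp ?_).continuousOn
      unfold contractionInvFun
      fun_prop

theorem contraction_coe {x : ℝ} (hx : x ∈ Ico (0 : ℝ) 1) :
    contraction (x : UnitAddCircle) = (contractionFun x : UnitAddCircle) :=
  AddCircle.liftIco_zero_coe_apply (f := fun x => (contractionFun x : UnitAddCircle)) hx

theorem affineNear_contraction {p q c x : ℝ} {k n : ℤ} (hp : 0 ≤ p) (hq : q ≤ 1)
    (h : ∀ y ∈ Ioo p q, contractionFun y = 2 ^ k * y + c) (hx : x - n ∈ Ioo p q) :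
    AffineNear contraction k (c + -(2 ^ k * n)) x := by
  have hcont : ContinuousAt (fun z : ℝ => z - n) x := by fun_prop
  filter_upwards [hcont.preimage_mem_nhds (Ioo_mem_nhds hx.1 hx.2)] with z hz
  have e : (z : UnitAddCircle) = ((z - n : ℝ) : UnitAddCircle) :=
    UnitAddCircle.coe_eq_coe.2 ⟨n, by ring⟩
  rw [e, contraction_coe ⟨hp.trans hz.1.le, hz.2.trans_le hq⟩, h _ hz]
  congr 1
  ring

theorem isThompson_contraction : IsThompson contraction := by
  classical
  rw [isThompson_iff_local]
  refine ⟨{((0 : ℝ) : UnitAddCircle), ((3 / 4 : ℝ) : UnitAddCircle),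
    ((7 / 8 : ℝ) : UnitAddCircle)}, ?_, fun x hx => ?_⟩
  · intro p hp
    simp only [Finset.mem_insert, Finset.mem_singleton] at hp
    rcases hp with rfl | rfl | rfl
    · exact ⟨0, .zero, rfl⟩
    · exact ⟨3 / 4, ⟨3, 2, by norm_num⟩, rfl⟩
    · exact ⟨7 / 8, ⟨7, 3, by norm_num⟩, rfl⟩
  · simp only [Finset.mem_insert, Finset.mem_singleton, not_or] at hx
    obtain ⟨hx0, hx1, hx2⟩ := hx
    have ne : ∀ y : ℝ, (x : UnitAddCircle) ≠ (y : UnitAddCircle) → x - ⌊x⌋ ≠ y :=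
      fun y hy h => hy (UnitAddCircle.coe_eq_coe.2 ⟨⌊x⌋, by linarith⟩)
    have hn := ((IsDyadic.int ⌊x⌋).zpow_mul · |>.neg)
    have h0 : 0 < x - ⌊x⌋ :=
      lt_of_le_of_ne (by linarith [Int.floor_le x]) (Ne.symm (ne 0 hx0))
    have h1 : x - ⌊x⌋ < 1 := by linarith [Int.lt_floor_add_one x]
    rcases lt_or_gt_of_ne (ne _ hx1) with h | h
    · refine ⟨-1, _, IsDyadic.zero.add (hn (-1)),
        affineNear_contraction le_rfl (by norm_num) (fun y hy => ?_) ⟨h0, h⟩⟩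
      rw [contractionFun_of_le hy.2.le, zpow_neg_one]
      ring
    rcases lt_or_gt_of_ne (ne _ hx2) with h' | h'
    · refine ⟨0, _, (show IsDyadic (-3 / 8) from ⟨-3, 3, by norm_num⟩).add (hn 0),
        affineNear_contraction (by norm_num) (by norm_num) (fun y hy => ?_) ⟨h, h'⟩⟩
      rw [contractionFun_of_mem hy.1.le hy.2.le, zpow_zero]
      ring
    · refine ⟨2, _, (show IsDyadic (-3) from ⟨-3, 0, by norm_num⟩).add (hn 2),
        affineNear_contraction (by norm_num) le_rfl (fun y hy => ?_) ⟨h', h1⟩⟩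
      rw [contractionFun_of_ge hy.1.le, zpow_ofNat]
      ring

/-- The action of `contraction` on binary expansions; words that are too short for one of the prefix
replacements are padded with zeros. -/
def contractWord : List Bool → List Bool
  | [] => [false, false]
  | false :: w => false :: false :: w
  | [true] => [false, true, false]
  | true :: false :: w => false :: true :: false :: w
  | [true, true] => [false, true, true]
  | true :: true :: false :: w => false :: true :: true :: w
  | true :: true :: true :: w => true :: w

theorem wordValue_contractWord (u : List Bool) :
    wordValue (contractWord u) = contractionFun (wordValue u) := by
  rcases u with _ | ⟨_ | _, _ | ⟨_ | _, _ | ⟨_ | _, w⟩⟩⟩ <;>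
    simp only [contractWord, wordValue, if_true, if_false, Bool.false_eq_true] <;>
    first
    | (rw [contractionFun_of_le (by linarith [wordValue_lt_one w])]; ring)
    | (rw [contractionFun_of_mem (by linarith [wordValue_nonneg w])
        (by linarith [wordValue_lt_one w])]; ring)
    | (rw [contractionFun_of_ge (by linarith [wordValue_nonneg w])]; ring)
    | (rw [contractionFun_of_le (by norm_num)]; ring)

theorem digitParity_contractWord (u : List Bool) :
    digitParity (contractWord u) = digitParity u := by
  have h2 : (1 : ZMod 2) + 1 = 0 := by decide
  rcases u with _ | ⟨_ | _, _ | ⟨_ | _, _ | ⟨_ | _, w⟩⟩⟩ <;>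
    simp [contractWord, digitParity]
  rw [← add_assoc 1 1, h2, zero_add]

theorem contraction_pow_wordValue (n : ℕ) (u : List Bool) :
    (contraction ^ n) (wordValue u : UnitAddCircle) =
      (wordValue (contractWord^[n] u) : UnitAddCircle) := by
  induction n with
  | zero => rfl
  | succ n ih =>
    rw [pow_succ', Function.iterate_succ_apply', wordValue_contractWord,
      ← contraction_coe (wordValue_mem_Ico _), ← ih]
    rfl

theorem digitParity_iterate_contractWord (n : ℕ) (u : List Bool) :
    digitParity (contractWord^[n] u) = digitParity u := by
  induction n with
  | zero => rfl
  | succ n ih => rw [Function.iterate_succ_apply', digitParity_contractWord, ih]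

theorem wordValue_iterate_contractWord_nil (n : ℕ) : wordValue (contractWord^[n] []) = 0 := by
  induction n with
  | zero => rfl
  | succ n ih =>
    rw [Function.iterate_succ_apply', wordValue_contractWord, ih,
      contractionFun_of_le (by norm_num), zero_div]

theorem exists_iterate_contractWord_eq_cons (u : List Bool) :
    ∃ (k : ℕ) (s : List Bool), contractWord^[k] u = false :: s := by
  match u with
  | [] => exact ⟨1, _, rfl⟩
  | false :: w => exact ⟨0, w, rfl⟩
  | [true] => exact ⟨1, _, rfl⟩
  | true :: false :: w => exact ⟨1, _, rfl⟩
  | [true, true] => exact ⟨1, _, rfl⟩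
  | true :: true :: false :: w => exact ⟨1, _, rfl⟩
  | true :: true :: true :: w =>
    obtain ⟨k, s, h⟩ := exists_iterate_contractWord_eq_cons (true :: w)
    exact ⟨k + 1, s, h⟩
  termination_by u.length

theorem iterate_contractWord_cons_false (n : ℕ) (s : List Bool) :
    contractWord^[n] (false :: s) = List.replicate n false ++ false :: s := by
  induction n with
  | zero => rfl
  | succ n ih =>
    rw [Function.iterate_succ_apply', ih]
    cases n <;> rfl

/-- The iterates of `contraction` move every dyadic point of `[0, 1)` towards `0`. -/
theorem exists_iterate_contractWord_eq_append (N : ℕ) (u : List Bool) :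
    ∃ K : ℕ, ∀ k ≥ K, ∃ s, contractWord^[k] u = List.replicate N false ++ s := by
  obtain ⟨k₀, s, h⟩ := exists_iterate_contractWord_eq_cons u
  refine ⟨N + k₀, fun k hk => ?_⟩
  obtain ⟨d, rfl⟩ := Nat.exists_eq_add_of_le hk
  refine ⟨List.replicate d false ++ false :: s, ?_⟩
  rw [show N + k₀ + d = (N + d) + k₀ by omega, Function.iterate_add_apply, h,
    iterate_contractWord_cons_false, List.replicate_add, List.append_assoc]

/-- `contraction` as an element of `T`. -/
noncomputable def thompsonContraction : thompsonT := ⟨contraction, isThompson_contraction⟩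

theorem thompsonContraction_mem_parityStabilizer : thompsonContraction ∈ parityStabilizer := by
  refine ⟨0, fun u v h => ?_⟩
  have h1 := contraction_pow_wordValue 1 u
  rw [pow_one] at h1
  rw [add_zero, ← digitParity_contractWord u]
  exact digitParity_eq_of_coe_eq (h.symm.trans h1)

/-! ### The commensurator -/

/-- If `g` conjugates a nontrivial power of the contraction into the stabilizer of the parity, then
`g` lies in it: the parity difference of `g x` and `x` is invariant under that power, and it is
constant near `0`. -/
theorem mem_parityStabilizer_of_conj_mem {g : thompsonT} {n : ℕ}
    (hn : 0 < n) (h : g * thompsonContraction ^ n * g⁻¹ ∈ parityStabilizer) :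
    g ∈ parityStabilizer := by
  obtain ⟨c, hc⟩ := h
  obtain ⟨N, hN⟩ := IsThompson.exists_mapsWord g.2
  obtain ⟨z, hz⟩ := hN (List.replicate N false) (by simp)
  choose γ hγ using IsThompson.exists_wordValue_eq g.2
  have step : ∀ u, digitParity (γ (contractWord^[n] u)) = digitParity (γ u) + c := by
    intro u
    apply hc
    rw [← hγ (contractWord^[n] u), ← contraction_pow_wordValue, ← hγ u]
    change (g : UnitAddCircle ≃ₜ UnitAddCircle)
      (((thompsonContraction ^ n : thompsonT) : UnitAddCircle ≃ₜ UnitAddCircle)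
      ((g : UnitAddCircle ≃ₜ UnitAddCircle).symm _)) = _
    rw [Homeomorph.symm_apply_apply]
    rfl
  -- the power fixes `0`, so the parity at `g 0` is compared with itself: the constant vanishes
  have c0 : c = 0 := by
    have h1 := step []
    have h2 : digitParity (γ (contractWord^[n] [])) = digitParity (γ []) := by
      apply digitParity_eq_of_coe_eq
      rw [← hγ, ← hγ, wordValue_iterate_contractWord_nil]
      rfl
    simpa [h2] using h1
  -- hence the parity of `g x` is invariant when `x` moves along the powers towards `0`
  have iter : ∀ k u, digitParity (γ (contractWord^[n * k] u)) = digitParity (γ u) := by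
    intro k u
    induction k with
    | zero => rfl
    | succ k ih =>
      rw [Nat.mul_succ, Nat.add_comm, Function.iterate_add_apply, step, c0, add_zero, ih]
  refine ⟨digitParity z, fun u v huv => ?_⟩
  obtain ⟨K, hK⟩ := exists_iterate_contractWord_eq_append N u
  obtain ⟨s, hs⟩ := hK (n * K) (Nat.le_mul_of_pos_left K hn)
  have h1 : digitParity (γ (contractWord^[n * K] u)) = digitParity (z ++ s) := by
    apply digitParity_eq_of_coe_eq
    rw [← hγ, hs]
    exact (hz.append s).map_wordValue
  have h2 : digitParity u = digitParity s := by
    rw [← digitParity_iterate_contractWord (n * K) u, hs, digitParity_append,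
      digitParity_replicate_false, zero_add]
  have h3 : digitParity v = digitParity (γ u) := digitParity_eq_of_coe_eq (huv.symm.trans (hγ u))
  rw [h3, ← iter K u, h1, digitParity_append, h2, add_comm]

open scoped Pointwise in
theorem commensurator_parityStabilizer :
    Subgroup.Commensurable.commensurator parityStabilizer = parityStabilizer := by
  ext t
  rw [Subgroup.Commensurable.commensurator_mem_iff]
  constructor
  · rintro ⟨h, -⟩
    obtain ⟨n, hn, -, h1, -⟩ :=
      Subgroup.exists_pow_mem_of_relIndex_ne_zero h thompsonContraction_mem_parityStabilizer
    replace h1 : thompsonContraction ^ n ∈ ConjAct.toConjAct t • parityStabilizer := h1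
    rw [Subgroup.mem_pointwise_smul_iff_inv_smul_mem, ← map_inv,
      ConjAct.toConjAct_smul] at h1
    exact (inv_mem_iff).1 (mem_parityStabilizer_of_conj_mem hn h1)
  · intro ht
    have h1 : ConjAct.toConjAct t • parityStabilizer = parityStabilizer := by
      ext x
      rw [Subgroup.mem_pointwise_smul_iff_inv_smul_mem, ← map_inv, ConjAct.toConjAct_smul,
        inv_inv, Subgroup.mul_mem_cancel_right _ ht,
        Subgroup.mul_mem_cancel_left _ (inv_mem ht)]
    rw [h1]

theorem mainTheorem3 :
    ∃ V : Subgroup thompsonT, (V : Set thompsonT) = jonesSet ∧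
      Subgroup.Commensurable.commensurator V = V :=
  ⟨parityStabilizer, parityStabilizer_eq_jonesSet, commensurator_parityStabilizer⟩
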